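/- **Conventions.** Let $X$ be a finite set and $X^*$ the $X$-regular rooted tree, whose vertices are the finite words over $X$. For $g\in\mathrm{Aut}(X^*)$ and a word $u$, the section $g|_u\in \mathrm{Aut}(X^*)$ is defined by $g(uv)=g(u)\,g|_u(v)$. We write $(x:g_x)_{x\in X}$ for the automorphism that fixes the first layer $X$ and has section $g_x$ at every $x\in X$; in listing its sections we omit the trivial ones. Conjugation is $a^b=b^{-1}ab$. Let $G\le\mathrm{Aut}(X^*)$. For a word $v$, $\mathrm{rist}_G(v)$ is the group of all $g\in G$ that move only vertices with prefix $v$, and $\mathrm{Rist}_G(m)=\langle \mathrm{rist}_G(v): |v|=m\rangle$. The group $G$ is *branch* if it is transitive on every layer $X^m$ and $\mathrm{Rist}_G(m)$ has finite index in $G$ for all $m$. It is *layered* if it is transitive on every layer, contains all sections of its elements, and contains $\{(x:g_x)_{x\in X}: g_x\in G\}$ as a subgroup of finite index. A group is *periodic* if all its elements have finite order, and $\mathcal{MF}$ is the class of groups all of whose maximal subgroups have finite index. Let $R$ be a finite group with identity $e$ and take $X=R$. Identify $r\in R$ with the *rooted* automorphism $xv\mapsto (rx)v$ ($x\in X$).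 An automorphism $d$ of $R^*$ is *directed* if it fixes the first layer, $d|_e=d$, and $d|_x\in R$ for all $x\ne e$. A group $G=\langle R\cup D\rangle$ is a *constant spinal group* with rooted group $R$ and directed group $D$ if $D$ is a group of directed automorphisms and $\langle d|_x: d\in D,\ x\neq e\rangle=R$. A *special* subgroup of $G$ is a $G$-conjugate of $\langle R\cup T\rangle$ for some $T\le D$. **Theorem.** There is a periodic branch group outside $\mathcal{MF}$. More precisely, let $n\ge5$ and $R=\mathrm{Alt}(n+2)$, and for $k\le n+2$ regard $\mathrm{Alt}(k)$ as the subgroup of $R$ acting on the first $k$ points. There are $q_0,q_1,\sigma\in R$ such that 1. no conjugate of $q_0$ or of $q_1$ lies in $\mathrm{Alt}(n+1)$; 2. $q_0$ and $q_1$ have order greater than $2$; 3. no cyclic subgroup of $R$ contains both a conjugate of $q_0$ and a conjugate of $q_1$ (in particular, $q_0$ and $q_1$ are not conjugate); 4. $\langle q_0\rangle\cap\langle q_1\rangle=\{e\}$; 5. $(q_0q_1^{-1})^2\ne e$; 6. $q_0^2\,q_0^{-1}q_1^{-1}q_0q_1\neq e$; 7. $q_1^{q_0}\notin\{q_1,q_1^{-1}\}$;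 8. $\langle \mathrm{Alt}(n)\cup\mathrm{Alt}(n)^\sigma\rangle=R$. For all $q_0,q_1,\sigma\in R$ with these properties, let $\varphi:R\to\mathrm{Aut}(R^*)$ be the homomorphism given by $$\varphi(r)=(e:\varphi(r),\ q_0:r,\ q_0^{-1}:r,\ q_1:r^\sigma,\ q_1^{-1}:r^\sigma),$$ and put $D=\varphi(\mathrm{Alt}(n+1))$, $T=\varphi(\mathrm{Alt}(n))$, $G=\langle R\cup D\rangle$, $H=\langle R\cup T\rangle$. Then $G$ is a layered constant spinal group with rooted group $R$ and directed group $D$, it is branch and periodic, and $G\notin\mathcal{MF}$: the special subgroup $H$ of $G$, which is itself a layered constant spinal group with rooted group $R$ and directed group $T$, is a maximal subgroup of $G$ of infinite index. -/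

import Mathlib

/-! ### The regular rooted tree and its automorphisms -/

namespace SpinalGroups

/-- The automorphism group of the `X`-regular rooted tree `X*`. The vertices are the finite words
over `X` (lists), and `v` is a descendant of `u` iff `u` is a prefix of `v`. An automorphism is a
permutation of the vertices that preserves the layers and the prefix relation. -/
def treeAut (X : Type*) : Subgroup (Equiv.Perm (List X)) where
  carrier := {g | (∀ u, (g u).length = u.length) ∧ ∀ u v, u <+: v → g u <+: g v}
  one_mem' := ⟨fun _ => rfl, fun _ _ h => h⟩
  mul_mem' := by
    rintro a b ⟨ha, ha'⟩ ⟨hb, hb'⟩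
    exact ⟨fun u => by simp [ha, hb], fun u v h => ha' _ _ (hb' _ _ h)⟩
  inv_mem' := by
    rintro g ⟨hg, hg'⟩
    have hl : ∀ u, (g⁻¹ u).length = u.length := fun u => by
      rw [← hg (g⁻¹ u)]; simp
    refine ⟨hl, fun u v h => ?_⟩
    have h1 : (g⁻¹ v).take u.length <+: g⁻¹ v := List.take_prefix _ _
    have h2 : g ((g⁻¹ v).take u.length) <+: v := by simpa using hg' _ _ h1
    have h3 : (g ((g⁻¹ v).take u.length)).length = u.length := by
      rw [hg, List.length_take, hl]; exact min_eq_left h.length_le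
    have h4 : g ((g⁻¹ v).take u.length) = u :=
      (List.prefix_of_prefix_length_le h2 h h3.le).eq_of_length h3
    have h5 : (g⁻¹ v).take u.length = g⁻¹ u := by
      rw [Equiv.Perm.eq_inv_iff_eq]; exact h4
    exact h5 ▸ h1

/-- `Aut(X*)`. -/
abbrev TreeAut (X : Type*) := ↥(treeAut X)

section Tree

variable {X : Type*}

theorem apply_append (g : TreeAut X) (u v : List X) :
    g.1 (u ++ v) = g.1 u ++ (g.1 (u ++ v)).drop u.length := by
  obtain ⟨w, hw⟩ := g.2.2 u (u ++ v) (List.prefix_append u v)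
  rw [← hw, ← g.2.1 u, List.drop_left]

/-- The section `g|_u` of `g` at the vertex `u`: the automorphism with `g (uv) = g(u) g|_u(v)`. -/
def sect (g : TreeAut X) (u : List X) : TreeAut X :=
  ⟨{ toFun := fun v => (g.1 (u ++ v)).drop u.length
     invFun := fun v => ((g⁻¹).1 (g.1 u ++ v)).drop u.length
     left_inv := fun v => by
       have h := apply_append g u v
       change ((g⁻¹).1 (g.1 u ++ (g.1 (u ++ v)).drop u.length)).drop u.length = v
       rw [← h]; simp
     right_inv := fun v => by
       have h := apply_append g⁻¹ (g.1 u) v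
       have h1 : (g⁻¹).1 (g.1 u) = u := by simp
       have h2 : (g.1 u).length = u.length := g.2.1 u
       rw [h1, h2] at h
       change (g.1 (u ++ ((g⁻¹).1 (g.1 u ++ v)).drop u.length)).drop u.length = v
       rw [← h]
       have h3 : g.1 ((g⁻¹).1 (g.1 u ++ v)) = g.1 u ++ v := by simp
       rw [h3, ← h2, List.drop_left] },
   by
     refine ⟨fun v => ?_, fun v w h => ?_⟩
     · simp [g.2.1]
     · have h1 : g.1 (u ++ v) <+: g.1 (u ++ w) :=
         g.2.2 _ _ ((List.prefix_append_right_inj u).2 h)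
       rw [apply_append g u v, apply_append g u w] at h1
       exact (List.prefix_append_right_inj _).1 h1⟩

/-- The vertex map of `(x : h x)_{x ∈ X}`. -/
def baseFun (h : X → List X → List X) : List X → List X
  | [] => []
  | x :: v => x :: h x v

/-- The embedding `ψ : Aut(X*)^X → Aut(X*)` onto the first layer stabiliser:
`base h = (x : h x)_{x ∈ X}` fixes the first layer and has section `h x` at `x`. -/
def base : (X → TreeAut X) →* TreeAut X where
  toFun h :=
    ⟨{ toFun := baseFun fun x => (h x).1
       invFun := baseFun fun x => ((h x)⁻¹).1
       left_inv := by rintro (_ | ⟨x, v⟩) <;> simp [baseFun]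
       right_inv := by rintro (_ | ⟨x, v⟩) <;> simp [baseFun] },
     by
       refine ⟨?_, ?_⟩
       · rintro (_ | ⟨x, v⟩)
         · rfl
         · simp [baseFun, (h x).2.1]
       · rintro (_ | ⟨x, v⟩) (_ | ⟨y, w⟩) hp
         · exact hp
         · simp [baseFun]
         · simp at hp
         · obtain ⟨rfl, hp'⟩ := List.cons_prefix_cons.1 hp
           exact List.cons_prefix_cons.2 ⟨rfl, (h x).2.2 _ _ hp'⟩⟩
  map_one' := by
    apply Subtype.ext; ext1 v; cases v <;> rfl
  map_mul' a b := by
    apply Subtype.ext; ext1 v; cases v <;> rfl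

/-- The vertex map of a rooted automorphism. -/
def rootedFun (s : X → X) : List X → List X
  | [] => []
  | x :: v => s x :: v

/-- The rooted automorphism acting as the permutation `s` on the first letter of a word. -/
def rooted : Equiv.Perm X →* TreeAut X where
  toFun s :=
    ⟨{ toFun := rootedFun s
       invFun := rootedFun s.symm
       left_inv := by rintro (_ | ⟨x, v⟩) <;> simp [rootedFun]
       right_inv := by rintro (_ | ⟨x, v⟩) <;> simp [rootedFun] },
     by
       refine ⟨?_, ?_⟩
       · rintro (_ | ⟨x, v⟩) <;> simp [rootedFun]
       · rintro (_ | ⟨x, v⟩) (_ | ⟨y, w⟩) hp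
         · exact hp
         · simp [rootedFun]
         · simp at hp
         · obtain ⟨rfl, hp'⟩ := List.cons_prefix_cons.1 hp
           exact List.cons_prefix_cons.2 ⟨rfl, hp'⟩⟩
  map_one' := by
    apply Subtype.ext; ext1 v; cases v <;> rfl
  map_mul' a b := by
    apply Subtype.ext; ext1 v; cases v <;> rfl

/-! ### Groups of tree automorphisms -/

/-- `G` acts transitively on every layer of the tree. -/
def SphericallyTransitive (G : Subgroup (TreeAut X)) : Prop :=
  ∀ u v : List X, u.length = v.length → ∃ g ∈ G, g.1 u = v

/-- `G` contains all sections of its elements. -/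
def SelfSimilar (G : Subgroup (TreeAut X)) : Prop :=
  ∀ g ∈ G, ∀ u : List X, sect g u ∈ G

/-- The rigid vertex stabiliser `rist_G(v)`: the elements of `G` that move only vertices
with prefix `v`. -/
def rist (G : Subgroup (TreeAut X)) (v : List X) : Subgroup (TreeAut X) where
  carrier := {g | g ∈ G ∧ ∀ w, ¬ v <+: w → g.1 w = w}
  one_mem' := ⟨G.one_mem, fun _ _ => rfl⟩
  mul_mem' := by
    rintro a b ⟨ha, ha'⟩ ⟨hb, hb'⟩
    refine ⟨G.mul_mem ha hb, fun w hw => ?_⟩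
    change a.1 (b.1 w) = w
    rw [hb' w hw, ha' w hw]
  inv_mem' := by
    rintro a ⟨ha, ha'⟩
    refine ⟨G.inv_mem ha, fun w hw => ?_⟩
    change a.1⁻¹ w = w
    rw [Equiv.Perm.inv_eq_iff_eq, ha' w hw]

/-- The `n`-th rigid layer stabiliser: the product of all `rist_G(v)` with `v` in layer `n`. -/
def layerRist (G : Subgroup (TreeAut X)) (n : ℕ) : Subgroup (TreeAut X) :=
  ⨆ v : {v : List X // v.length = n}, rist G v.1

/-- Branch groups: spherically transitive groups all of whose rigid layer stabilisers have
finite index. -/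
def IsBranch (G : Subgroup (TreeAut X)) : Prop :=
  SphericallyTransitive G ∧ ∀ n : ℕ, ((layerRist G n).subgroupOf G).FiniteIndex

/-- The subgroup `ψ(H^X)` of `Aut(X*)`. -/
def geometricPower (H : Subgroup (TreeAut X)) : Subgroup (TreeAut X) :=
  (Subgroup.pi Set.univ fun _ : X => H).map base

/-- `G` is regular branch over `K`: `G` is spherically transitive, `K` is a finite index subgroup
of `G`, and `ψ(K^X)` is a finite index subgroup of `K`. -/
def IsRegularBranchOver (G K : Subgroup (TreeAut X)) : Prop :=
  SphericallyTransitive G ∧ K ≤ G ∧ (K.subgroupOf G).FiniteIndex ∧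
    geometricPower K ≤ K ∧ ((geometricPower K).subgroupOf K).FiniteIndex

/-- Layered groups: self-similar groups that are regular branch over themselves. -/
def IsLayered (G : Subgroup (TreeAut X)) : Prop :=
  SelfSimilar G ∧ IsRegularBranchOver G G

end Tree

/-- The class `MF`: all maximal subgroups have finite index. -/
def IsMF (G : Type*) [Group G] : Prop :=
  ∀ M : Subgroup G, IsCoatom M → M.FiniteIndex

/-- Periodic groups: every element has finite order. -/
def IsPeriodic (G : Type*) [Group G] : Prop :=
  ∀ g : G, IsOfFinOrder g

/-- `H` is a maximal subgroup of `G` of infinite index. -/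
def IsMaximalOfInfiniteIndex {A : Type*} [Group A] (H G : Subgroup A) : Prop :=
  H ≤ G ∧ IsCoatom (H.subgroupOf G) ∧ ¬ (H.subgroupOf G).FiniteIndex

/-! ### Constant spinal groups

The alphabet is (the underlying set of) a group `R`, acting on itself by left multiplication;
its distinguished letter is `1 : R`. -/

section Spinal

variable {R : Type*} [Group R]

/-- `R` as a group of rooted automorphisms of the tree `R*`. -/
def root : R →* TreeAut R := rooted.comp (MulAction.toPermHom R R)

/-- `d` is a directed automorphism of the form `d = (1 : d, x : r_x (x ≠ 1))` with `r_x ∈ R`. -/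
def IsDirected (d : TreeAut R) : Prop :=
  (∀ x : R, d.1 [x] = [x]) ∧ sect d [1] = d ∧ ∀ x : R, x ≠ 1 → sect d [x] ∈ (root (R := R)).range

/-- The group generated by the rooted group `R` and the group `D`. -/
def spinalGroup (D : Subgroup (TreeAut R)) : Subgroup (TreeAut R) :=
  (root (R := R)).range ⊔ D

/-- `G = ⟨R ∪ D⟩` is a constant spinal group with rooted group `R` and directed group `D`: the
group `D` consists of directed automorphisms, and the sections `d|_x` with `d ∈ D`, `x ≠ 1`
generate `R`. -/
structure IsConstantSpinal (G D : Subgroup (TreeAut R)) : Prop where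
  directed : ∀ d ∈ D, IsDirected d
  gen : Subgroup.closure {s | ∃ d ∈ D, ∃ x : R, x ≠ 1 ∧ s = sect d [x]} = (root (R := R)).range
  eq_spinalGroup : G = spinalGroup D

/-- `H` is a special subgroup of `G = ⟨R ∪ D⟩`: a `G`-conjugate of `⟨R ∪ T⟩` with `T ≤ D`. -/
def IsSpecial (H G D : Subgroup (TreeAut R)) : Prop :=
  ∃ T ≤ D, ∃ g ∈ G, H = (spinalGroup T).map (MulAut.conj g).toMonoidHom

variable [DecidableEq R]

/-- The vertex map of the directed automorphism with sections `a x` at the letters `x ≠ 1`. -/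
def spineFun (a : R → R) : List R → List R
  | [] => []
  | x :: v => x :: if x = 1 then spineFun a v else rootedFun (a x * ·) v

theorem spineFun_spineFun (a b : R → R) (v : List R) :
    spineFun a (spineFun b v) = spineFun (a * b) v := by
  induction v with
  | nil => rfl
  | cons x v ih =>
    by_cases hx : x = 1
    · simp [spineFun, hx, ih]
    · cases v <;> simp [spineFun, hx, rootedFun, mul_assoc]

theorem spineFun_one (v : List R) : spineFun (1 : R → R) v = v := by
  induction v with
  | nil => rfl
  | cons x v ih =>
    by_cases hx : x = 1
    · simp [spineFun, hx, ih]
    · cases v <;> simp [spineFun, hx, rootedFun]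

/-- The directed automorphism `d = (1 : d, x : a x (x ≠ 1))`; the value `a 1` is not used. -/
def spine : (R → R) →* TreeAut R where
  toFun a :=
    ⟨{ toFun := spineFun a
       invFun := spineFun a⁻¹
       left_inv := fun v => by rw [spineFun_spineFun, inv_mul_cancel, spineFun_one]
       right_inv := fun v => by rw [spineFun_spineFun, mul_inv_cancel, spineFun_one] },
     by
       refine ⟨fun v => ?_, fun v => ?_⟩
       · change (spineFun a v).length = v.length
         induction v with
         | nil => rfl
         | cons x v ih =>
           by_cases hx : x = 1
           · simp [spineFun, hx, ih]
           · cases v <;> simp [spineFun, hx, rootedFun]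
       · change ∀ w, v <+: w → spineFun a v <+: spineFun a w
         induction v with
         | nil => intro w _; simp [spineFun]
         | cons x v ih =>
           rintro (_ | ⟨y, w⟩) hp
           · simp at hp
           · obtain ⟨rfl, hp'⟩ := List.cons_prefix_cons.1 hp
             refine List.cons_prefix_cons.2 ⟨rfl, ?_⟩
             by_cases hx : x = 1
             · simpa [hx] using ih w hp'
             · simp only [hx, if_false]
               exact (rooted (MulAction.toPerm (a x))).2.2 _ _ hp'⟩
  map_one' := by
    apply Subtype.ext; ext1 v; exact spineFun_one v
  map_mul' a b := by
    apply Subtype.ext; ext1 v; exact (spineFun_spineFun a b v).symm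

theorem sect_spine_one (a : R → R) : sect (spine a) [1] = spine a := by
  apply Subtype.ext; ext1 v
  change (spineFun a (1 :: v)).drop 1 = spineFun a v
  simp [spineFun]

theorem sect_spine_ne (a : R → R) {x : R} (hx : x ≠ 1) : sect (spine a) [x] = root (a x) := by
  apply Subtype.ext; ext1 v
  change (spineFun a (x :: v)).drop 1 = rootedFun (a x * ·) v
  simp [spineFun, hx]

theorem isDirected_spine (a : R → R) : IsDirected (spine a) := by
  refine ⟨fun x => ?_, sect_spine_one a, fun x hx => ⟨a x, (sect_spine_ne a hx).symm⟩⟩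
  change spineFun a [x] = [x]
  by_cases hx : x = 1 <;> simp [spineFun, hx, rootedFun]

/-- The homomorphism `φ` sending `r` to the directed automorphism
`φ(r) = (1 : φ(r), q₀ : r, q₀⁻¹ : r, q₁ : r^σ, q₁⁻¹ : r^σ)`, where `r^σ = σ⁻¹ r σ`. -/
def phi (q₀ q₁ σ : R) : R →* TreeAut R :=
  spine.comp
    { toFun := fun r x =>
        if x = q₀ ∨ x = q₀⁻¹ then r else if x = q₁ ∨ x = q₁⁻¹ then σ⁻¹ * r * σ else 1
      map_one' := by
        funext x; simp
      map_mul' := fun r s => by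
        funext x
        simp only [Pi.mul_apply]
        split_ifs <;> simp [mul_assoc] }

end Spinal

/-! ### The family of examples -/

/-- The alternating group on `m` points. -/
abbrev Alt (m : ℕ) := ↥(alternatingGroup (Fin m))

/-- `Alt(k)` as a subgroup of `Alt(m)`: the even permutations of the first `k` points. -/
def altSub (m k : ℕ) : Subgroup (Alt m) where
  carrier := {g | ∀ i : Fin m, k ≤ i.1 → g.1 i = i}
  one_mem' := fun _ _ => rfl
  mul_mem' := by
    intro a b ha hb i hi
    change a.1 (b.1 i) = i
    rw [hb i hi, ha i hi]
  inv_mem' := by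
    intro a ha i hi
    change a.1⁻¹ i = i
    rw [Equiv.Perm.inv_eq_iff_eq, ha i hi]

/-- The conditions on `q₀, q₁, σ ∈ R = Alt(n+2)`. -/
structure Admissible (n : ℕ) (q₀ q₁ σ : Alt (n + 2)) : Prop where
  conj_notMem₀ : ∀ g : Alt (n + 2), g⁻¹ * q₀ * g ∉ altSub (n + 2) (n + 1)
  conj_notMem₁ : ∀ g : Alt (n + 2), g⁻¹ * q₁ * g ∉ altSub (n + 2) (n + 1)
  two_lt_order₀ : 2 < orderOf q₀
  two_lt_order₁ : 2 < orderOf q₁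
  /-- No cyclic subgroup meets both conjugacy classes; in particular, `q₀` and `q₁` are not
  conjugate. -/
  not_common_power : ∀ r x y : Alt (n + 2),
    x ∈ Subgroup.zpowers r → y ∈ Subgroup.zpowers r → ¬ (IsConj q₀ x ∧ IsConj q₁ y)
  inf_zpowers : Subgroup.zpowers q₀ ⊓ Subgroup.zpowers q₁ = ⊥
  mul_inv_sq : (q₀ * q₁⁻¹) ^ 2 ≠ 1
  sq_mul_comm : q₀ ^ 2 * (q₀⁻¹ * q₁⁻¹ * q₀ * q₁) ≠ 1
  conj_ne : q₀⁻¹ * q₁ * q₀ ≠ q₁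
  conj_ne_inv : q₀⁻¹ * q₁ * q₀ ≠ q₁⁻¹
  /-- `Alt(n)` and `Alt(n)^σ` together generate `Alt(n+2)`. -/
  generate : altSub (n + 2) n ⊔
    (altSub (n + 2) n).map (MulAut.conj σ⁻¹).toMonoidHom = ⊤

/-- `φ(Alt(k))` for the data `q₀, q₁, σ ∈ Alt(n+2)`. -/
def directedAlt (n : ℕ) (q₀ q₁ σ : Alt (n + 2)) (k : ℕ) : Subgroup (TreeAut (Alt (n + 2))) :=
  (altSub (n + 2) k).map (phi q₀ q₁ σ)

end SpinalGroups

open SpinalGroups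

namespace SpinalGroups

/-! ### Calculus of sections, and automorphisms supported below one letter. -/

section Tree

variable {X : Type*}

/-! Write A for Alt(n) or Alt(n+1) inside the simple group R, and S = {1, q₀, q₀⁻¹, q₁, q₁⁻¹} for
the letters at which φ(r) can have a nontrivial section. Everything rests on four facts.

Self-replication (`geometricPower_phi_le`): ⟨R ∪ φ(A)⟩ contains every (x : g_x) with sections in the
group itself. The relations excluded for q₀, q₁ make S and its translate q₀q₁⁻¹S meet only in q₀, so
the commutator of φ(s) with a rooted conjugate of φ(t) lives at one letter and is a commutator of s
with t^σ there. Since A and A^σ generate R, such commutators cannot all vanish, and simplicity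
yields every rooted element at every letter. Layeredness follows, and with it the branch property,
because layer stabilisers lie in the rigid ones.

Maximality (`spinalGroup_le_of_mem_of_sectionsShort`): let H ≤ M ≤ G with g in M outside H. Deep
enough, all sections of g lie in R ∪ D. One descends to such a depth, where a section in D outside T
appears. Maximality of Alt(n) in Alt(n+1) then yields D. On the way back up, M projects onto G at
some letter x, and {k : (x : k) ∈ M} contains H and is normalised by G. As the conjugates of Alt(n)
generate Alt(n+1), this subgroup is G, so M = G. The index is infinite because placing elements at
one letter induces an injective but not surjective self-map of G/H
(`not_finiteIndex_of_geometricPower_le`).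

Periodicity (`isOfFinOrder_wordVal_of_lettersIn`): induct on the number of directed letters in a
word w. If w acts on the first layer by ρ, the first-layer sections of its ord(ρ)-th power have no
more directed letters than w. If one has equally many, then, up to conjugation, its rooted letters
are sections of directed elements at letters of one cyclic group. That group cannot involve both q₀
and q₁, so the rooted letters all lie in A or all in A^σ. Neither contains a conjugate of q₀ or q₁,
so at the next such step they disappear and an element of the finite group φ(R) remains.

Existence (`exists_admissible`) uses permutations obtained from an (n+2)-cycle by a few
transpositions, according to the parity of n. -/

theorem treeAut_ext {g h : TreeAut X} (H : ∀ v, g.1 v = h.1 v) : g = h :=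
  Subtype.ext (Equiv.ext H)

theorem exists_apply_singleton (g : TreeAut X) (x : X) : ∃ y, g.1 [x] = [y] :=
  List.length_eq_one_iff.1 (g.2.1 [x])

theorem apply_append_sect (g : TreeAut X) (u v : List X) :
    g.1 (u ++ v) = g.1 u ++ (sect g u).1 v :=
  apply_append g u v

theorem apply_nil (g : TreeAut X) : g.1 [] = [] :=
  List.length_eq_zero_iff.1 (g.2.1 [])

theorem apply_cons (g : TreeAut X) (x : X) (v : List X) :
    g.1 (x :: v) = g.1 [x] ++ (sect g [x]).1 v :=
  apply_append g [x] v

theorem sect_eq_of_apply {g h : TreeAut X} {u : List X}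
    (H : ∀ v, g.1 (u ++ v) = g.1 u ++ h.1 v) : sect g u = h := by
  refine treeAut_ext fun v => ?_
  have := H v
  rw [apply_append_sect] at this
  exact List.append_cancel_left this

theorem sect_nil (g : TreeAut X) : sect g [] = g :=
  sect_eq_of_apply fun v => by simp [apply_nil]

theorem sect_mul (g h : TreeAut X) (u : List X) :
    sect (g * h) u = sect g (h.1 u) * sect h u := by
  refine sect_eq_of_apply fun v => ?_
  change g.1 (h.1 (u ++ v)) = g.1 (h.1 u) ++ (sect g (h.1 u)).1 ((sect h u).1 v)
  rw [apply_append_sect h, apply_append_sect g]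

theorem sect_one (u : List X) : sect (1 : TreeAut X) u = 1 :=
  sect_eq_of_apply fun _ => rfl

theorem sect_inv (g : TreeAut X) (u : List X) :
    sect g⁻¹ u = (sect g (g⁻¹.1 u))⁻¹ := by
  rw [eq_inv_iff_mul_eq_one, ← sect_one (g.1⁻¹ u)]
  have h := sect_mul g⁻¹ g (g⁻¹.1 u)
  have h1 : g.1 (g⁻¹.1 u) = u := by simp
  rw [h1, inv_mul_cancel] at h
  exact h.symm

theorem sect_cons (g : TreeAut X) (x : X) (v : List X) :
    sect g (x :: v) = sect (sect g [x]) v := by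
  refine sect_eq_of_apply fun w => ?_
  rw [List.cons_append, apply_cons, apply_cons g x v, apply_append_sect, List.append_assoc]

theorem inv_apply_of_apply {g : TreeAut X} {u v : List X} (h : g.1 u = v) : g⁻¹.1 v = u := by
  simp [← h]

/-- `g` fixes the first layer. -/
def FixesLetters (g : TreeAut X) : Prop := ∀ x : X, g.1 [x] = [x]

theorem FixesLetters.mul {g h : TreeAut X} (hg : FixesLetters g) (hh : FixesLetters h) :
    FixesLetters (g * h) := fun x => by
  change g.1 (h.1 [x]) = [x]
  rw [hh, hg]

theorem FixesLetters.inv {g : TreeAut X} (hg : FixesLetters g) : FixesLetters g⁻¹ :=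
  fun x => inv_apply_of_apply (hg x)

theorem fixesLetters_one : FixesLetters (1 : TreeAut X) := fun _ => rfl

theorem fixesLetters_base (h : X → TreeAut X) : FixesLetters (base h) := fun x => by
  change x :: (h x).1 [] = [x]
  rw [apply_nil]

theorem sect_base (h : X → TreeAut X) (x : X) : sect (base h) [x] = h x :=
  sect_eq_of_apply fun v => by
    rw [fixesLetters_base h x]; rfl

theorem FixesLetters.sect_mul {h : TreeAut X} (g : TreeAut X) (hh : FixesLetters h) (x : X) :
    sect (g * h) [x] = sect g [x] * sect h [x] := by
  rw [SpinalGroups.sect_mul, hh]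

theorem FixesLetters.sect_inv {g : TreeAut X} (hg : FixesLetters g) (x : X) :
    sect g⁻¹ [x] = (sect g [x])⁻¹ := by
  rw [SpinalGroups.sect_inv, hg.inv]

theorem FixesLetters.eq_of_sect {g h : TreeAut X} (hg : FixesLetters g) (hh : FixesLetters h)
    (H : ∀ x, sect g [x] = sect h [x]) : g = h := by
  refine treeAut_ext fun v => ?_
  rcases v with _ | ⟨x, v⟩
  · rw [apply_nil, apply_nil]
  · rw [apply_cons, apply_cons h, hg, hh, H]

theorem FixesLetters.eq_base {g : TreeAut X} (hg : FixesLetters g) :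
    g = base fun x => sect g [x] :=
  hg.eq_of_sect (fixesLetters_base _) fun x => by rw [sect_base]

theorem mem_geometricPower {K : Subgroup (TreeAut X)} {g : TreeAut X} :
    g ∈ geometricPower K ↔ FixesLetters g ∧ ∀ x, sect g [x] ∈ K := by
  constructor
  · rintro ⟨h, hh, rfl⟩
    exact ⟨fixesLetters_base h, fun x => by rw [sect_base]; exact hh x trivial⟩
  · rintro ⟨h1, h2⟩
    exact ⟨_, fun x _ => h2 x, h1.eq_base.symm⟩

/-- The embedding `g ↦ (x : g)`. -/
def baseSingle [DecidableEq X] (x : X) : TreeAut X →* TreeAut X :=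
  base.comp (MonoidHom.mulSingle (fun _ : X => TreeAut X) x)

section Single
variable [DecidableEq X]

theorem fixesLetters_baseSingle (x : X) (g : TreeAut X) : FixesLetters (baseSingle x g) :=
  fixesLetters_base _

theorem sect_baseSingle_self (x : X) (g : TreeAut X) : sect (baseSingle x g) [x] = g := by
  simp [baseSingle, sect_base]

theorem sect_baseSingle_ne {x y : X} (h : y ≠ x) (g : TreeAut X) :
    sect (baseSingle x g) [y] = 1 := by
  simp [baseSingle, sect_base, h]

theorem base_mem_of_baseSingle_mem [Finite X] {K : Subgroup (TreeAut X)} {h : X → TreeAut X}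
    (H : ∀ x, baseSingle x (h x) ∈ K) : base h ∈ K :=
  Subgroup.pi_mem_of_mulSingle_mem (H := K.comap base) h H

theorem geometricPower_le_of_baseSingle [Finite X] {K M : Subgroup (TreeAut X)}
    (H : ∀ x, ∀ g ∈ K, baseSingle x g ∈ M) : geometricPower K ≤ M := by
  rintro _ ⟨h, hh, rfl⟩
  exact base_mem_of_baseSingle_mem fun x => H x _ (hh x trivial)

theorem baseSingle_mem_geometricPower {K : Subgroup (TreeAut X)} (x : X) {g : TreeAut X}
    (hg : g ∈ K) : baseSingle x g ∈ geometricPower K := by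
  refine mem_geometricPower.2 ⟨fixesLetters_baseSingle x g, fun y => ?_⟩
  by_cases h : y = x
  · subst h; rwa [sect_baseSingle_self]
  · rw [sect_baseSingle_ne h]; exact K.one_mem

theorem FixesLetters.baseSingle_conj {a : TreeAut X} (ha : FixesLetters a) (x : X)
    (k : TreeAut X) :
    baseSingle x (sect a [x] * k * (sect a [x])⁻¹) = a * baseSingle x k * a⁻¹ := by
  have hf := fixesLetters_baseSingle x k
  refine (fixesLetters_baseSingle x _).eq_of_sect ((ha.mul hf).mul ha.inv) fun y => ?_
  rw [ha.inv.sect_mul, hf.sect_mul, ha.sect_inv]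
  by_cases hy : y = x
  · subst hy; rw [sect_baseSingle_self, sect_baseSingle_self]
  · rw [sect_baseSingle_ne hy, sect_baseSingle_ne hy, mul_one, mul_inv_cancel]

/-- The sections at the letter `x` of the elements of `M` that fix the first layer. -/
def letterProjection (M : Subgroup (TreeAut X)) (x : X) : Subgroup (TreeAut X) where
  carrier := {k | ∃ h ∈ M, FixesLetters h ∧ sect h [x] = k}
  one_mem' := ⟨1, M.one_mem, fixesLetters_one, sect_one _⟩
  mul_mem' := by
    rintro _ _ ⟨a, ha, ha', rfl⟩ ⟨b, hb, hb', rfl⟩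
    exact ⟨a * b, M.mul_mem ha hb, ha'.mul hb', hb'.sect_mul a x⟩
  inv_mem' := by
    rintro _ ⟨a, ha, ha', rfl⟩
    exact ⟨a⁻¹, M.inv_mem ha, ha'.inv, ha'.sect_inv x⟩

/-- Conjugating (x : k) by an element that fixes the first layer only sees that element's section at
x. Hence what `M` contains at the letter x is normalised by what `M` projects to at x. -/
theorem conj_mem_comap_baseSingle {M : Subgroup (TreeAut X)} {x : X} {p k : TreeAut X}
    (hp : p ∈ letterProjection M x) (hk : k ∈ M.comap (baseSingle x)) :
    p * k * p⁻¹ ∈ M.comap (baseSingle x) := by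
  obtain ⟨a, ha, ha', rfl⟩ := hp
  rw [Subgroup.mem_comap, ha'.baseSingle_conj]
  exact M.mul_mem (M.mul_mem ha hk) (M.inv_mem ha)

/-- For a letter x, the map g ↦ (x : g) induces an injection of G/H into itself, since sections of
elements of `H` at x lie in `H`. If k is in `G` outside `H` and y ≠ x, the coset of (y : k) is not
in the image: the section at y would put k in `H`. A finite set admits no such map. -/
theorem not_finiteIndex_of_geometricPower_le [Nontrivial X] {H G : Subgroup (TreeAut X)}
    (hs : SelfSimilar H) (hG : geometricPower G ≤ G) (hne : ¬ G ≤ H) :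
    ¬ (H.subgroupOf G).FiniteIndex := by
  intro hf
  obtain ⟨x, y, hxy⟩ := exists_pair_ne X
  obtain ⟨k, hk, hkH⟩ := SetLike.not_le_iff_exists.1 hne
  let b (x : X) (g : G) : G := ⟨baseSingle x g.1, hG (baseSingle_mem_geometricPower x g.2)⟩
  let f : G ⧸ H.subgroupOf G → G ⧸ H.subgroupOf G := fun q => (b x q.out : G)
  have hf : Function.Injective f := by
    intro p q hpq
    have h1 : (baseSingle x p.out.1)⁻¹ * baseSingle x q.out.1 ∈ H :=
      (QuotientGroup.eq (s := H.subgroupOf G)).1 hpq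
    rw [← map_inv, ← map_mul] at h1
    have h2 := hs _ h1 [x]
    rw [sect_baseSingle_self] at h2
    rw [← Quotient.out_eq' p, ← Quotient.out_eq' q]
    exact QuotientGroup.eq.2 h2
  obtain ⟨q, hq⟩ := (Finite.injective_iff_surjective.1 hf) (b y ⟨k, hk⟩ : G)
  have h1 : (baseSingle x q.out.1)⁻¹ * baseSingle y k ∈ H :=
    (QuotientGroup.eq (s := H.subgroupOf G)).1 hq
  have h2 := hs _ h1 [y]
  rw [← map_inv, (fixesLetters_baseSingle y k).sect_mul, sect_baseSingle_ne hxy.symm,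
    sect_baseSingle_self, one_mul] at h2
  exact hkH h2

end Single

theorem isOfFinOrder_base [Finite X] {h : X → TreeAut X} (H : ∀ x, IsOfFinOrder (h x)) :
    IsOfFinOrder (base h) := by
  have := Fintype.ofFinite X
  refine isOfFinOrder_iff_pow_eq_one.2 ⟨∏ x, orderOf (h x),
    Finset.prod_pos fun x _ => (H x).orderOf_pos, ?_⟩
  rw [← map_pow]
  have : h ^ (∏ x, orderOf (h x)) = 1 := by
    funext x
    exact orderOf_dvd_iff_pow_eq_one.1 (Finset.dvd_prod_of_mem _ (Finset.mem_univ x))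
  rw [this, map_one]

/-! ### Layer stabilisers -/

/-- The action of `Aut(X*)` on the layer of words of length `m`. -/
def layerAction (X : Type*) (m : ℕ) :
    TreeAut X →* Equiv.Perm {v : List X // v.length = m} where
  toFun g := g.1.subtypePerm fun v => by rw [g.2.1]
  map_one' := rfl
  map_mul' _ _ := rfl

theorem mem_ker_layerAction {m : ℕ} {g : TreeAut X} :
    g ∈ (layerAction X m).ker ↔ ∀ v : List X, v.length = m → g.1 v = v := by
  rw [MonoidHom.mem_ker]
  constructor
  · intro h v hv
    exact congrArg Subtype.val (Equiv.congr_fun h ⟨v, hv⟩)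
  · intro h
    ext v : 2
    exact h v.1 v.2

theorem finiteIndex_ker_layerAction [Finite X] (m : ℕ) : (layerAction X m).ker.FiniteIndex := by
  have : Finite {v : List X // v.length = m} := inferInstanceAs (Finite (List.Vector X m))
  infer_instance

theorem finiteIndex_subgroupOf_of_ker_le [Finite X] {K G : Subgroup (TreeAut X)} (m : ℕ)
    (H : ∀ g ∈ G, g ∈ (layerAction X m).ker → g ∈ K) : (K.subgroupOf G).FiniteIndex := by
  have := finiteIndex_ker_layerAction (X := X) m
  have h : (layerAction X m).ker.subgroupOf G ≤ K.subgroupOf G := fun g hg => H g g.2 hg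
  exact Subgroup.finiteIndex_of_le h

theorem fixesLetters_of_mem_ker {m : ℕ} {g : TreeAut X} [Nonempty X]
    (h : g ∈ (layerAction X (m + 1)).ker) : FixesLetters g := by
  intro x
  have h1 := mem_ker_layerAction.1 h (x :: List.replicate m x) (by simp)
  rw [apply_cons] at h1
  obtain ⟨y, hy⟩ := exists_apply_singleton g x
  rw [hy] at h1 ⊢
  simp only [List.cons_append, List.cons.injEq] at h1
  rw [h1.1]

theorem sect_mem_ker_layerAction {m : ℕ} {g : TreeAut X} [Nonempty X]
    (h : g ∈ (layerAction X (m + 1)).ker) (x : X) : sect g [x] ∈ (layerAction X m).ker := by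
  refine mem_ker_layerAction.2 fun v hv => ?_
  have h1 := mem_ker_layerAction.1 h (x :: v) (by simp [hv])
  rw [apply_cons, fixesLetters_of_mem_ker h] at h1
  simpa using h1

theorem finiteIndex_geometricPower [Finite X] {G : Subgroup (TreeAut X)} (hG : SelfSimilar G) :
    ((geometricPower G).subgroupOf G).FiniteIndex :=
  finiteIndex_subgroupOf_of_ker_le 1 fun g hg h =>
    mem_geometricPower.2 ⟨fun x => mem_ker_layerAction.1 h [x] rfl, fun x => hG g hg [x]⟩

theorem layerRist_of_baseSingle [DecidableEq X] {G : Subgroup (TreeAut X)}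
    (hG : geometricPower G ≤ G) (m : ℕ) (x : X) {g : TreeAut X} (hg : g ∈ layerRist G m) :
    baseSingle x g ∈ layerRist G (m + 1) := by
  have : layerRist G m ≤ (layerRist G (m + 1)).comap (baseSingle x) := by
    refine iSup_le fun v => ?_
    rintro h ⟨hh, hh'⟩
    refine Subgroup.mem_iSup_of_mem (⟨x :: v.1, by simp [v.2]⟩ : {v : List X // v.length = m + 1})
      ⟨hG (baseSingle_mem_geometricPower x hh), fun w hw => ?_⟩
    rcases w with _ | ⟨y, w⟩
    · exact apply_nil _
    · rw [apply_cons, fixesLetters_baseSingle]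
      by_cases hy : y = x
      · subst hy
        rw [sect_baseSingle_self, hh' w fun h => hw (List.cons_prefix_cons.2 ⟨rfl, h⟩)]
        rfl
      · rw [sect_baseSingle_ne hy]; rfl
  exact this hg

/-- An element fixing layer m + 1 is the product of its first-layer sections, each placed at its
letter. These sections fix layer m, so induction applies. Thus the rigid layer stabiliser contains a
layer stabiliser, which has finite index. -/
theorem mem_layerRist_of_mem_ker [Finite X] [Nonempty X] {G : Subgroup (TreeAut X)}
    (hs : SelfSimilar G) (hG : geometricPower G ≤ G) (m : ℕ) :
    ∀ g ∈ G, g ∈ (layerAction X m).ker → g ∈ layerRist G m := by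
  classical
  induction m with
  | zero =>
    intro g hg _
    exact Subgroup.mem_iSup_of_mem (⟨[], rfl⟩ : {v : List X // v.length = 0})
      ⟨hg, fun w hw => absurd (List.nil_prefix) hw⟩
  | succ m ih =>
    intro g hg hk
    rw [(fixesLetters_of_mem_ker hk).eq_base]
    exact base_mem_of_baseSingle_mem fun x => layerRist_of_baseSingle hG m x
      (ih _ (hs g hg [x]) (sect_mem_ker_layerAction hk x))

theorem IsLayered.isBranch [Finite X] [Nonempty X] {G : Subgroup (TreeAut X)}
    (hG : IsLayered G) : IsBranch G :=
  ⟨hG.2.1, fun m => finiteIndex_subgroupOf_of_ker_le m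
    (mem_layerRist_of_mem_ker hG.1 hG.2.2.2.2.1 m)⟩

end Tree

/-! ### Groups generated by rooted and directed automorphisms -/

section Spinal

variable {R : Type*} [Group R]

theorem root_apply_cons (r x : R) (v : List R) : (root r).1 (x :: v) = (r * x) :: v := rfl

theorem sect_root (r x : R) : sect (root r) [x] = 1 :=
  sect_eq_of_apply fun _ => rfl

theorem eq_one_of_root_fixesLetters {r : R} (h : FixesLetters (root r)) : r = 1 := by
  simpa [root_apply_cons] using h 1

theorem root_injective : Function.Injective (root (R := R)) :=
  (injective_iff_map_eq_one _).2 fun _ h =>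
    eq_one_of_root_fixesLetters (h ▸ fixesLetters_one)

theorem sect_conj_root (r : R) {g : TreeAut R} (x : R) :
    sect (root r * g * (root r)⁻¹) [x] = sect g [r⁻¹ * x] := by
  rw [← map_inv, sect_mul, sect_mul, sect_root, root_apply_cons, mul_one]
  obtain ⟨y, hy⟩ := exists_apply_singleton g (r⁻¹ * x)
  rw [hy, sect_root, one_mul]

theorem FixesLetters.conj_root {g : TreeAut R} (hg : FixesLetters g) (r : R) :
    FixesLetters (root r * g * (root r)⁻¹) := fun x => by
  rw [← map_inv]
  change (root r).1 (g.1 ((root r⁻¹).1 [x])) = [x]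
  rw [root_apply_cons, hg, root_apply_cons, mul_inv_cancel_left]

theorem conj_root_baseSingle [DecidableEq R] (r x : R) (g : TreeAut R) :
    root r * baseSingle x g * (root r)⁻¹ = baseSingle (r * x) g := by
  refine ((fixesLetters_baseSingle x g).conj_root r).eq_of_sect (fixesLetters_baseSingle _ g)
    fun y => ?_
  rw [sect_conj_root]
  by_cases h : y = r * x
  · subst h; rw [inv_mul_cancel_left, sect_baseSingle_self, sect_baseSingle_self]
  · rw [sect_baseSingle_ne h, sect_baseSingle_ne fun h' => h (by rw [← h', mul_inv_cancel_left])]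

theorem root_mem_spinalGroup (D : Subgroup (TreeAut R)) (r : R) : root r ∈ spinalGroup D :=
  (le_sup_left : (root (R := R)).range ≤ spinalGroup D) ⟨r, rfl⟩

theorem le_spinalGroup (D : Subgroup (TreeAut R)) : D ≤ spinalGroup D := le_sup_right

theorem spinalGroup_le {D K : Subgroup (TreeAut R)} (hR : ∀ r : R, root r ∈ K) (hD : D ≤ K) :
    spinalGroup D ≤ K :=
  sup_le (by rintro _ ⟨r, rfl⟩; exact hR r) hD

theorem spinalGroup_mono {D T : Subgroup (TreeAut R)} (h : T ≤ D) :
    spinalGroup T ≤ spinalGroup D := sup_le_sup_left h _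

/-- The automorphisms that act on the first layer by left multiplication and whose
first layer sections lie in `K`. -/
def letterwise (K : Subgroup (TreeAut R)) : Subgroup (TreeAut R) where
  carrier := {g | (∃ r : R, ∀ x, g.1 [x] = [r * x]) ∧ ∀ x, sect g [x] ∈ K}
  one_mem' := ⟨⟨1, fun x => by simp⟩, fun x => by rw [sect_one]; exact K.one_mem⟩
  mul_mem' := by
    rintro a b ⟨⟨r, hr⟩, ha⟩ ⟨⟨s, hs⟩, hb⟩
    refine ⟨⟨r * s, fun x => ?_⟩, fun x => ?_⟩
    · change a.1 (b.1 [x]) = _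
      rw [hs, hr, mul_assoc]
    · rw [sect_mul, hs]; exact K.mul_mem (ha _) (hb _)
  inv_mem' := by
    rintro a ⟨⟨r, hr⟩, ha⟩
    have h : ∀ x, a⁻¹.1 [x] = [r⁻¹ * x] := fun x =>
      inv_apply_of_apply (by rw [hr, mul_inv_cancel_left])
    refine ⟨⟨r⁻¹, h⟩, fun x => ?_⟩
    rw [sect_inv, h]; exact K.inv_mem (ha _)

variable {D : Subgroup (TreeAut R)}

theorem IsDirected.sect_mem {d : TreeAut R} (hd : IsDirected d) (hD : d ∈ D) (x : R) :
    sect d [x] ∈ spinalGroup D := by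
  by_cases hx : x = 1
  · subst hx; rw [hd.2.1]; exact le_spinalGroup D hD
  · obtain ⟨r, hr⟩ := hd.2.2 x hx
    rw [← hr]; exact root_mem_spinalGroup D r

theorem spinalGroup_le_letterwise (hD : ∀ d ∈ D, IsDirected d) :
    spinalGroup D ≤ letterwise (spinalGroup D) := by
  refine spinalGroup_le (fun r => ⟨⟨r, fun _ => rfl⟩, fun x => ?_⟩) fun d hd =>
    ⟨⟨1, fun x => by rw [one_mul]; exact (hD d hd).1 x⟩, (hD d hd).sect_mem hd⟩
  rw [sect_root]; exact one_mem _

theorem selfSimilar_spinalGroup (hD : ∀ d ∈ D, IsDirected d) : SelfSimilar (spinalGroup D) := by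
  intro g hg u
  induction u generalizing g with
  | nil => rwa [sect_nil]
  | cons x v ih =>
    rw [sect_cons]
    exact ih _ ((spinalGroup_le_letterwise hD hg).2 x)

theorem exists_root_mul_fixesLetters (hD : ∀ d ∈ D, IsDirected d) {g : TreeAut R}
    (hg : g ∈ spinalGroup D) : ∃ r : R, FixesLetters (root r * g) := by
  obtain ⟨⟨r, hr⟩, -⟩ := spinalGroup_le_letterwise hD hg
  refine ⟨r⁻¹, fun x => ?_⟩
  change (root r⁻¹).1 (g.1 [x]) = [x]
  rw [hr, root_apply_cons, inv_mul_cancel_left]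

theorem sect_root_mul (r : R) (g : TreeAut R) (x : R) : sect (root r * g) [x] = sect g [x] := by
  rw [sect_mul]
  obtain ⟨y, hy⟩ := exists_apply_singleton g x
  rw [hy, sect_root, one_mul]

theorem spinalGroup_le_of_geometricPower_le (hD : ∀ d ∈ D, IsDirected d)
    {M : Subgroup (TreeAut R)} (hR : ∀ r : R, root r ∈ M)
    (hM : geometricPower (spinalGroup D) ≤ M) : spinalGroup D ≤ M := by
  intro g hg
  obtain ⟨r, hr⟩ := exists_root_mul_fixesLetters hD hg
  refine (M.mul_mem_cancel_left (hR r)).1 (hM (mem_geometricPower.2 ⟨hr, fun x => ?_⟩))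
  rw [sect_root_mul]
  exact selfSimilar_spinalGroup hD g hg [x]

theorem sphericallyTransitive_of_geometricPower_le {G : Subgroup (TreeAut R)}
    (hR : ∀ r : R, root r ∈ G) (hG : geometricPower G ≤ G) : SphericallyTransitive G := by
  classical
  intro u
  induction u with
  | nil => intro v h; exact ⟨1, G.one_mem, (List.length_eq_zero_iff.1 h.symm).symm⟩
  | cons x u ih =>
    rintro (_ | ⟨y, v⟩) h
    · simp at h
    · obtain ⟨g, hg, rfl⟩ := ih v (by simpa using h)
      refine ⟨root (y * x⁻¹) * baseSingle x g,
        G.mul_mem (hR _) (hG (baseSingle_mem_geometricPower x hg)), ?_⟩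
      change (root (y * x⁻¹)).1 ((baseSingle x g).1 (x :: u)) = _
      rw [apply_cons, fixesLetters_baseSingle, sect_baseSingle_self, List.singleton_append,
        root_apply_cons, inv_mul_cancel_right]

theorem isLayered_spinalGroup [Finite R] (hD : ∀ d ∈ D, IsDirected d)
    (hG : geometricPower (spinalGroup D) ≤ spinalGroup D) : IsLayered (spinalGroup D) := by
  have hs := selfSimilar_spinalGroup hD
  refine ⟨hs, sphericallyTransitive_of_geometricPower_le (root_mem_spinalGroup D) hG, le_rfl,
    ?_, hG, finiteIndex_geometricPower hs⟩
  rw [Subgroup.subgroupOf_self]; infer_instance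

/-- All sections of `g` at the words of length `m` lie in `R ∪ D`. -/
def SectionsShort (D : Subgroup (TreeAut R)) : ℕ → TreeAut R → Prop
  | 0, g => g ∈ (root (R := R)).range ∨ g ∈ D
  | m + 1, g => ∀ x : R, SectionsShort D m (sect g [x])

theorem SectionsShort.succ (hD : ∀ d ∈ D, IsDirected d) {m : ℕ} {g : TreeAut R}
    (hg : SectionsShort D m g) : SectionsShort D (m + 1) g := by
  induction m generalizing g with
  | zero =>
    intro x
    rcases hg with ⟨r, rfl⟩ | hg
    · rw [sect_root]; exact Or.inr D.one_mem
    · by_cases hx : x = 1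
      · subst hx; rw [(hD g hg).2.1]; exact Or.inr hg
      · exact Or.inl ((hD g hg).2.2 x hx)
  | succ m ih => exact fun x => ih (hg x)

theorem SectionsShort.mono (hD : ∀ d ∈ D, IsDirected d) {m k : ℕ} (h : m ≤ k) {g : TreeAut R}
    (hg : SectionsShort D m g) : SectionsShort D k g := by
  induction h with
  | refl => exact hg
  | step _ ih => exact ih.succ hD

/-- Depth grows by only one, since a product of two elements of R ∪ D has first-layer sections in R
∪ D: rooted factors only permute the letters, and `D` is closed under products. -/
theorem SectionsShort.mul (hD : ∀ d ∈ D, IsDirected d) {m : ℕ} {g h : TreeAut R}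
    (hg : SectionsShort D m g) (hh : SectionsShort D m h) : SectionsShort D (m + 1) (g * h) := by
  induction m generalizing g h with
  | zero =>
    have hg0 := hg
    rcases hg with ⟨r, rfl⟩ | hg'
    · intro x
      rw [sect_root_mul]
      exact SectionsShort.succ hD hh x
    · rcases hh with ⟨r, rfl⟩ | hh'
      · intro x
        rw [sect_mul, sect_root, mul_one, root_apply_cons]
        exact SectionsShort.succ hD hg0 _
      · exact SectionsShort.succ hD (m := 0) (Or.inr (D.mul_mem hg' hh'))
  | succ m ih =>
    intro x
    obtain ⟨y, hy⟩ := exists_apply_singleton h x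
    rw [sect_mul, hy]
    exact ih (hg y) (hh x)

theorem SectionsShort.inv {m : ℕ} {g : TreeAut R} (hg : SectionsShort D m g) :
    SectionsShort D m g⁻¹ := by
  induction m generalizing g with
  | zero =>
    rcases hg with hg | hg
    · exact Or.inl (inv_mem hg)
    · exact Or.inr (inv_mem hg)
  | succ m ih =>
    intro x
    obtain ⟨y, hy⟩ := exists_apply_singleton g⁻¹ x
    rw [sect_inv, hy]
    exact ih (hg y)

theorem exists_sectionsShort (hD : ∀ d ∈ D, IsDirected d) {g : TreeAut R}
    (hg : g ∈ spinalGroup D) : ∃ m, SectionsShort D m g := by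
  let K : Subgroup (TreeAut R) :=
    { carrier := {g | ∃ m, SectionsShort D m g}
      one_mem' := ⟨0, Or.inr D.one_mem⟩
      mul_mem' := by
        rintro a b ⟨m, hm⟩ ⟨k, hk⟩
        exact ⟨_, (hm.mono hD (le_max_left m k)).mul hD (hk.mono hD (le_max_right m k))⟩
      inv_mem' := by
        rintro a ⟨m, hm⟩
        exact ⟨m, hm.inv⟩ }
  exact spinalGroup_le (K := K) (fun r => ⟨0, Or.inl ⟨r, rfl⟩⟩) (fun d hd => ⟨0, Or.inr hd⟩) hg

/-- Following the letter 1 reproduces d at every depth, so d itself is rooted or in `D`; a rooted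
automorphism fixing the first layer is trivial. -/
theorem IsDirected.mem_of_sectionsShort {d : TreeAut R} (hd : IsDirected d) {m : ℕ}
    (h : SectionsShort D m d) : d ∈ D := by
  induction m with
  | zero =>
    rcases h with ⟨r, rfl⟩ | h
    · rw [eq_one_of_root_fixesLetters hd.1, map_one]; exact D.one_mem
    · exact h
  | succ m ih => exact ih (hd.2.1 ▸ h 1)

theorem IsDirected.mem_of_mem_spinalGroup (hD : ∀ d ∈ D, IsDirected d) {d : TreeAut R}
    (hd : IsDirected d) (h : d ∈ spinalGroup D) : d ∈ D :=
  hd.mem_of_sectionsShort (exists_sectionsShort hD h).choose_spec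

/-! ### Maximality and infinite index of special subgroups -/

section Special

variable [DecidableEq R] {T : Subgroup (TreeAut R)}

/-- Induction on the depth at which the sections of g become short, for all intermediate groups at
once, because the step passes from `M` to its projection at a letter. `hmax` is used at the bottom;
`hnormal` lifts the conclusion back through each layer. -/
theorem spinalGroup_le_of_mem_of_sectionsShort [Finite R] (hD : ∀ d ∈ D, IsDirected d)
    (hH : geometricPower (spinalGroup T) ≤ spinalGroup T)
    (hmax : ∀ K : Subgroup (TreeAut R), T ≤ K → ∀ d ∈ D, d ∈ K → d ∉ T → D ≤ K)
    (hnormal : ∀ K : Subgroup (TreeAut R), T ≤ K → (∀ d ∈ D, ∀ k ∈ K, d * k * d⁻¹ ∈ K) → D ≤ K)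
    (m : ℕ) : ∀ M : Subgroup (TreeAut R), spinalGroup T ≤ M → M ≤ spinalGroup D →
      ∀ g ∈ M, g ∉ spinalGroup T → SectionsShort D m g → spinalGroup D ≤ M := by
  induction m with
  | zero =>
    intro M hTM _ g hgM hgT hg
    rcases hg with ⟨r, rfl⟩ | hg
    · exact absurd (root_mem_spinalGroup T r) hgT
    · exact spinalGroup_le (fun r => hTM (root_mem_spinalGroup T r))
        (hmax M ((le_spinalGroup T).trans hTM) g hg hgM fun h => hgT (le_spinalGroup T h))
  | succ m ih =>
    intro M hTM hMD g hgM hgT hg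
    have hRM : ∀ r : R, root r ∈ M := fun r => hTM (root_mem_spinalGroup T r)
    obtain ⟨r, hr⟩ := exists_root_mul_fixesLetters hD (hMD hgM)
    -- Otherwise g would be, up to a rooted factor, an element of ψ(H^R), which lies in H.
    obtain ⟨x, hx⟩ : ∃ x, sect g [x] ∉ spinalGroup T := by
      by_contra! hall
      refine hgT (((spinalGroup T).mul_mem_cancel_left (root_mem_spinalGroup T r)).1
        (hH (mem_geometricPower.2 ⟨hr, fun x => ?_⟩)))
      rw [sect_root_mul]; exact hall x
    have hP : spinalGroup D ≤ letterProjection M x := by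
      refine ih _ (fun k hk => ⟨baseSingle x k, hTM (hH (baseSingle_mem_geometricPower x hk)),
        fixesLetters_baseSingle x k, sect_baseSingle_self x k⟩) ?_ (sect g [x])
        ⟨root r * g, M.mul_mem (hRM r) hgM, hr, sect_root_mul r g x⟩ hx (hg x)
      rintro _ ⟨a, ha, -, rfl⟩
      exact selfSimilar_spinalGroup hD a (hMD ha) [x]
    have hTK : spinalGroup T ≤ M.comap (baseSingle x) := fun k hk =>
      hTM (hH (baseSingle_mem_geometricPower x hk))
    -- The projection being all of ⟨R ∪ D⟩, conjugation by every element of `D` is available at the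
    -- letter x.
    have hDK : spinalGroup D ≤ M.comap (baseSingle x) :=
      spinalGroup_le (fun r => hTK (root_mem_spinalGroup T r))
        (hnormal _ ((le_spinalGroup T).trans hTK) fun d hd k hk =>
          conj_mem_comap_baseSingle (hP (le_spinalGroup D hd)) hk)
    refine spinalGroup_le_of_geometricPower_le hD hRM (geometricPower_le_of_baseSingle ?_)
    intro y k hk
    have := M.mul_mem (M.mul_mem (hRM (y * x⁻¹)) (hDK hk)) (M.inv_mem (hRM (y * x⁻¹)))
    rwa [conj_root_baseSingle, inv_mul_cancel_right] at this

theorem isMaximalOfInfiniteIndex_spinalGroup [Finite R] [Nontrivial R]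
    (hD : ∀ d ∈ D, IsDirected d) (hTD : T ≤ D) (hne : ¬ D ≤ T)
    (hG : geometricPower (spinalGroup D) ≤ spinalGroup D)
    (hH : geometricPower (spinalGroup T) ≤ spinalGroup T)
    (hmax : ∀ K : Subgroup (TreeAut R), T ≤ K → ∀ d ∈ D, d ∈ K → d ∉ T → D ≤ K)
    (hnormal : ∀ K : Subgroup (TreeAut R), T ≤ K →
      (∀ d ∈ D, ∀ k ∈ K, d * k * d⁻¹ ∈ K) → D ≤ K) :
    IsMaximalOfInfiniteIndex (spinalGroup T) (spinalGroup D) := by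
  have hT : ∀ d ∈ T, IsDirected d := fun d hd => hD d (hTD hd)
  have hle : spinalGroup T ≤ spinalGroup D := spinalGroup_mono hTD
  have hnle : ¬ spinalGroup D ≤ spinalGroup T := fun h => hne fun d hd =>
    (hD d hd).mem_of_mem_spinalGroup hT (h (le_spinalGroup D hd))
  refine ⟨hle, ⟨fun h => hnle (Subgroup.subgroupOf_eq_top.1 h), fun M hM => ?_⟩,
    not_finiteIndex_of_geometricPower_le (selfSimilar_spinalGroup hT) hG hnle⟩
  obtain ⟨hM1, hM2⟩ := SetLike.lt_iff_le_and_exists.1 hM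
  obtain ⟨g, hgM, hg⟩ := hM2
  obtain ⟨m, hm⟩ := exists_sectionsShort hD g.2
  have := spinalGroup_le_of_mem_of_sectionsShort hD hH hmax hnormal m
    (M.map (spinalGroup D).subtype) (fun h hh => ⟨⟨h, hle hh⟩, hM1 hh, rfl⟩)
    (Subgroup.map_subtype_le M) g.1 ⟨g, hgM, rfl⟩ hg hm
  refine eq_top_iff.2 fun k _ => ?_
  obtain ⟨k', hk', h⟩ := this k.2
  rwa [← Subtype.ext h]

end Special

end Spinal

/-! ### Generation by a subgroup and one of its conjugates. -/

section ConjGenerates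

variable {R : Type*} [Group R] {σ : R}

/-- `⟨A ∪ A^σ⟩ = R`. -/
def ConjGenerates (A : Subgroup R) (σ : R) : Prop :=
  A ⊔ A.map (MulAut.conj σ⁻¹).toMonoidHom = ⊤

theorem ConjGenerates.eq_top {A : Subgroup R} (hA : ConjGenerates A σ) {K : Subgroup R}
    (h : ∀ s ∈ A, s ∈ K) (h' : ∀ s ∈ A, σ⁻¹ * s * σ ∈ K) : K = ⊤ := by
  refine eq_top_iff.2 (hA.symm.trans_le (sup_le h ?_))
  rintro _ ⟨s, hs, rfl⟩
  simpa using h' s hs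

end ConjGenerates

/-! ### The groups ⟨R ∪ φ(A)⟩ and their self-replication. -/

section Phi

variable {R : Type*} [Group R] [DecidableEq R] {q₀ q₁ σ : R}

/-- The rooted sections of `φ(r)` away from the letter `1`. -/
def phiSection (q₀ q₁ σ r x : R) : R :=
  if x = q₀ ∨ x = q₀⁻¹ then r else if x = q₁ ∨ x = q₁⁻¹ then σ⁻¹ * r * σ else 1

theorem isDirected_phi (q₀ q₁ σ r : R) : IsDirected (phi q₀ q₁ σ r) := isDirected_spine _

theorem sect_phi_one (q₀ q₁ σ r : R) : sect (phi q₀ q₁ σ r) [1] = phi q₀ q₁ σ r :=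
  sect_spine_one _

theorem sect_phi_ne (q₀ q₁ σ r : R) {x : R} (hx : x ≠ 1) :
    sect (phi q₀ q₁ σ r) [x] = root (phiSection q₀ q₁ σ r x) :=
  sect_spine_ne _ hx

theorem isDirected_of_mem_map_phi {A : Subgroup R} :
    ∀ d ∈ A.map (phi q₀ q₁ σ), IsDirected d := by
  rintro _ ⟨r, -, rfl⟩
  exact isDirected_phi q₀ q₁ σ r

theorem sect_phi_self₀ (h : q₀ ≠ 1) (r : R) : sect (phi q₀ q₁ σ r) [q₀] = root r := by
  rw [sect_phi_ne _ _ _ _ h]; simp [phiSection]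

theorem sect_phi_self₁ (h : q₁ ≠ 1) (h₀ : q₁ ≠ q₀) (h₀' : q₁ ≠ q₀⁻¹) (r : R) :
    sect (phi q₀ q₁ σ r) [q₁] = root (σ⁻¹ * r * σ) := by
  rw [sect_phi_ne _ _ _ _ h]; simp [phiSection, h₀, h₀']

theorem phi_injective (h : q₀ ≠ 1) : Function.Injective (phi q₀ q₁ σ) := fun r s hrs => by
  have := congrArg (fun g => sect g [q₀]) hrs
  simp only [sect_phi_self₀ h] at this
  exact root_injective this

theorem sect_phi_eq_one {x : R} (h : x ∉ ({1, q₀, q₀⁻¹, q₁, q₁⁻¹} : Set R)) (r : R) :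
    sect (phi q₀ q₁ σ r) [x] = 1 := by
  simp only [Set.mem_insert_iff, Set.mem_singleton_iff, not_or] at h
  rw [sect_phi_ne _ _ _ _ h.1]
  simp [phiSection, h]

theorem isConstantSpinal_phi {A : Subgroup R} (h0 : q₀ ≠ 1) (h1 : q₁ ≠ 1) (h10 : q₁ ≠ q₀)
    (h10' : q₁ ≠ q₀⁻¹) (hA : ConjGenerates A σ) :
    IsConstantSpinal (spinalGroup (A.map (phi q₀ q₁ σ))) (A.map (phi q₀ q₁ σ)) := by
  refine ⟨isDirected_of_mem_map_phi, le_antisymm ?_ ?_, rfl⟩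
  · rw [Subgroup.closure_le]
    rintro _ ⟨_, ⟨r, -, rfl⟩, x, hx, rfl⟩
    exact (isDirected_phi q₀ q₁ σ r).2.2 x hx
  · rintro _ ⟨r, rfl⟩
    set K := Subgroup.closure {s | ∃ d ∈ A.map (phi q₀ q₁ σ), ∃ x : R, x ≠ 1 ∧ s = sect d [x]}
    have : K.comap root = ⊤ := hA.eq_top
      (fun s hs => Subgroup.subset_closure
        ⟨_, ⟨s, hs, rfl⟩, q₀, h0, (sect_phi_self₀ h0 s).symm⟩)
      (fun s hs => Subgroup.subset_closure
        ⟨_, ⟨s, hs, rfl⟩, q₁, h1, (sect_phi_self₁ h1 h10 h10' s).symm⟩)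
    exact (this ▸ Subgroup.mem_top r : r ∈ K.comap root)

theorem baseSingle_mem_iff {D : Subgroup (TreeAut R)} {x y : R} {g : TreeAut R} :
    baseSingle x g ∈ spinalGroup D ↔ baseSingle y g ∈ spinalGroup D := by
  have key : ∀ x y : R, baseSingle x g ∈ spinalGroup D → baseSingle y g ∈ spinalGroup D := by
    intro x y h
    have hr := root_mem_spinalGroup D (y * x⁻¹)
    have := mul_mem (mul_mem hr h) (inv_mem hr)
    rwa [conj_root_baseSingle, inv_mul_cancel_right] at this
  exact ⟨key x y, key y x⟩

/-- With r = q₀q₁⁻¹, the conjugate of φ(t) by r has its sections moved from S to rS. By `hS` the two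
supports share only q₀ = rq₁, where the sections are s and t^σ; away from q₀ the commutator has
trivial sections. -/
theorem baseSingle_commutator_mem {A : Subgroup R} (h0 : q₀ ≠ 1) (h1 : q₁ ≠ 1) (h10 : q₁ ≠ q₀)
    (h10' : q₁ ≠ q₀⁻¹)
    (hS : ∀ x ∈ ({1, q₀, q₀⁻¹, q₁, q₁⁻¹} : Set R),
      (q₀ * q₁⁻¹)⁻¹ * x ∈ ({1, q₀, q₀⁻¹, q₁, q₁⁻¹} : Set R) → x = q₀)
    {s t : R} (hs : s ∈ A) (ht : t ∈ A) :
    baseSingle q₀ (root (s * (σ⁻¹ * t * σ) * s⁻¹ * (σ⁻¹ * t * σ)⁻¹)) ∈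
      spinalGroup (A.map (phi q₀ q₁ σ)) := by
  set r := q₀ * q₁⁻¹ with hr
  have hfs : FixesLetters (phi q₀ q₁ σ s) := (isDirected_phi q₀ q₁ σ s).1
  have hft : FixesLetters (root r * phi q₀ q₁ σ t * (root r)⁻¹) :=
    FixesLetters.conj_root (isDirected_phi q₀ q₁ σ t).1 r
  have hms : phi q₀ q₁ σ s ∈ spinalGroup (A.map (phi q₀ q₁ σ)) :=
    le_spinalGroup _ ⟨s, hs, rfl⟩
  have hmt : root r * phi q₀ q₁ σ t * (root r)⁻¹ ∈ spinalGroup (A.map (phi q₀ q₁ σ)) :=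
    mul_mem (mul_mem (root_mem_spinalGroup _ r) (le_spinalGroup _ ⟨t, ht, rfl⟩))
      (inv_mem (root_mem_spinalGroup _ r))
  have : baseSingle q₀ (root (s * (σ⁻¹ * t * σ) * s⁻¹ * (σ⁻¹ * t * σ)⁻¹)) =
      phi q₀ q₁ σ s * (root r * phi q₀ q₁ σ t * (root r)⁻¹) * (phi q₀ q₁ σ s)⁻¹ *
        (root r * phi q₀ q₁ σ t * (root r)⁻¹)⁻¹ := by
    refine (fixesLetters_baseSingle _ _).eq_of_sect
      (((hfs.mul hft).mul hfs.inv).mul hft.inv) fun x => ?_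
    rw [hft.inv.sect_mul, hfs.inv.sect_mul, hft.sect_mul, hft.sect_inv, hfs.sect_inv,
      sect_conj_root]
    by_cases hx : x = q₀
    · subst hx
      have : r⁻¹ * x = q₁ := by rw [hr]; group
      rw [this, sect_baseSingle_self, sect_phi_self₀ h0, sect_phi_self₁ h1 h10 h10']
      simp only [map_mul, map_inv]
    · rw [sect_baseSingle_ne hx]
      by_cases hxS : x ∈ ({1, q₀, q₀⁻¹, q₁, q₁⁻¹} : Set R)
      · rw [sect_phi_eq_one fun h => hx (hS x hxS h)]; group
      · rw [sect_phi_eq_one hxS]; group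
  rw [this]
  exact mul_mem (mul_mem (mul_mem hms hmt) (inv_mem hms)) (inv_mem hmt)

/-- The rooted elements available at a single letter form a normal subgroup of R. It is nontrivial
by the commutators above, hence all of R. Dividing φ(s) by its rooted sections then leaves (1 :
φ(s)). -/
theorem geometricPower_phi_le [Finite R] [IsSimpleGroup R] {A : Subgroup R} (h0 : q₀ ≠ 1)
    (h1 : q₁ ≠ 1) (h10 : q₁ ≠ q₀) (h10' : q₁ ≠ q₀⁻¹)
    (hS : ∀ x ∈ ({1, q₀, q₀⁻¹, q₁, q₁⁻¹} : Set R),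
      (q₀ * q₁⁻¹)⁻¹ * x ∈ ({1, q₀, q₀⁻¹, q₁, q₁⁻¹} : Set R) → x = q₀)
    (hA : ConjGenerates A σ) (hbot : A ≠ ⊥) (htop : A ≠ ⊤) :
    geometricPower (spinalGroup (A.map (phi q₀ q₁ σ))) ≤ spinalGroup (A.map (phi q₀ q₁ σ)) := by
  set G := spinalGroup (A.map (phi q₀ q₁ σ)) with hG
  have hphi : ∀ s ∈ A, phi q₀ q₁ σ s ∈ G := fun s hs => le_spinalGroup _ ⟨s, hs, rfl⟩
  have hproj : (letterProjection G 1).comap root = ⊤ := by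
    have hmem : ∀ x : R, ∀ s ∈ A, sect (phi q₀ q₁ σ s) [x] ∈ letterProjection G 1 := by
      intro x s hs
      refine ⟨root x⁻¹ * phi q₀ q₁ σ s * (root x⁻¹)⁻¹,
        mul_mem (mul_mem (root_mem_spinalGroup _ _) (hphi s hs))
          (inv_mem (root_mem_spinalGroup _ _)),
        -- Conjugating by the rooted x⁻¹ transports the section at x to the letter 1.
        FixesLetters.conj_root (isDirected_phi q₀ q₁ σ s).1 _, ?_⟩
      rw [sect_conj_root, inv_inv, mul_one]
    refine hA.eq_top (fun s hs => ?_) (fun s hs => ?_)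
    · have := hmem q₀ s hs
      rwa [sect_phi_self₀ h0] at this
    · have := hmem q₁ s hs
      rwa [sect_phi_self₁ h1 h10 h10'] at this
  let N : Subgroup R := (G.comap (baseSingle 1)).comap root
  have hN : N.Normal := ⟨fun n hn k => by
    have hk : root k ∈ letterProjection G 1 := (hproj ▸ Subgroup.mem_top k :
      k ∈ (letterProjection G 1).comap root)
    have := conj_mem_comap_baseSingle hk hn
    rwa [← map_inv, ← map_mul, ← map_mul] at this⟩
  have hcomm : ∀ s ∈ A, ∀ t ∈ A, s * (σ⁻¹ * t * σ) * s⁻¹ * (σ⁻¹ * t * σ)⁻¹ ∈ N :=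
    fun s hs t ht => baseSingle_mem_iff.1
      (baseSingle_commutator_mem h0 h1 h10 h10' hS hs ht)
  -- If `N` were trivial, A^σ would centralise `A`; then `A` would be normal in ⟨A ∪ A^σ⟩ = R,
  -- against simplicity.
  have hNtop : N = ⊤ := by
    refine hN.eq_bot_or_eq_top.resolve_left fun hb => ?_
    have hAN : Subgroup.normalizer (A : Set R) = ⊤ := hA.eq_top (fun s hs => Subgroup.le_normalizer hs) ?_
    · exact (Subgroup.normalizer_eq_top_iff.1 hAN).eq_bot_or_eq_top.elim hbot htop
    · intro t ht
      have hc : ∀ s ∈ A, (σ⁻¹ * t * σ) * s = s * (σ⁻¹ * t * σ) := by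
        intro s hs
        have := hcomm s hs t ht
        rw [hb, Subgroup.mem_bot, mul_inv_eq_one, mul_inv_eq_iff_eq_mul] at this
        exact this.symm
      rw [Subgroup.mem_normalizer_iff]
      intro s
      constructor
      · intro hs
        rwa [hc s hs, mul_inv_cancel_right]
      · intro hs
        have := hc _ hs
        rw [inv_mul_cancel_right, mul_left_cancel_iff] at this
        rwa [this] at hs
  have hroot : ∀ x r : R, baseSingle x (root r) ∈ G := fun x r =>
    baseSingle_mem_iff.1 (hNtop ▸ Subgroup.mem_top r : r ∈ N)
  refine geometricPower_le_of_baseSingle fun x => ?_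
  refine spinalGroup_le (K := G.comap (baseSingle x)) (hroot x) ?_
  rintro _ ⟨s, hs, rfl⟩
  refine baseSingle_mem_iff (x := 1).1 ?_
  -- The part of φ(s) away from the letter 1. It is in `G` because its sections are all rooted.
  let h : R → TreeAut R := fun y => if y = 1 then 1 else root (phiSection q₀ q₁ σ s y)
  have hh : base h ∈ G := base_mem_of_baseSingle_mem fun y => by
    by_cases hy : y = 1
    · simp only [h, hy, if_true, map_one]; exact one_mem _
    · simp only [h, hy, if_false]; exact hroot _ _
  have : phi q₀ q₁ σ s = baseSingle 1 (phi q₀ q₁ σ s) * base h := by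
    refine FixesLetters.eq_of_sect (isDirected_phi q₀ q₁ σ s).1
      ((fixesLetters_baseSingle _ _).mul (fixesLetters_base h)) fun y => ?_
    rw [(fixesLetters_base h).sect_mul, sect_base]
    by_cases hy : y = 1
    · subst hy; simp [h, sect_baseSingle_self, sect_phi_one]
    · simp [h, hy, sect_baseSingle_ne hy, sect_phi_ne _ _ _ _ hy]
  exact (mul_mem_cancel_right hh).1 (this ▸ hphi s hs)

end Phi

/-! ### Words in rooted and directed letters, and periodicity. -/

section Periodic

theorem sum_countP_le {α : Type*} (k : ℕ) (P : ℕ → α → Bool) (L : List α)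
    (h : ∀ p, ∀ i < k, ∀ j < k, P i p → P j p → i = j) :
    ∑ j ∈ Finset.range k, L.countP (P j) ≤ L.length := by
  induction L with
  | nil => simp
  | cons p L ih =>
    have h1 : ∑ j ∈ Finset.range k, (if P j p then 1 else 0) ≤ 1 := by
      rw [← Finset.card_filter, Finset.card_le_one]
      simp only [Finset.mem_filter, Finset.mem_range]
      exact fun i hi j hj => h p i hi.1 j hj.1 hi.2 hj.2
    simp only [List.countP_cons, Finset.sum_add_distrib, List.length_cons]
    omega

theorem sum_countP_lt {α : Type*} (k : ℕ) (P : ℕ → α → Bool) (L : List α)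
    (h : ∀ p, ∀ i < k, ∀ j < k, P i p → P j p → i = j) {p : α} (hp : p ∈ L)
    (hP : ∀ j < k, ¬ P j p) :
    ∑ j ∈ Finset.range k, L.countP (P j) < L.length := by
  obtain ⟨L₁, L₂, rfl⟩ := List.append_of_mem hp
  have h1 := sum_countP_le k P L₁ h
  have h2 := sum_countP_le k P L₂ h
  have h3 : ∑ j ∈ Finset.range k, (if P j p then 1 else 0) = 0 :=
    Finset.sum_eq_zero fun j hj => if_neg (hP j (Finset.mem_range.1 hj))
  simp only [List.countP_append, List.countP_cons, Finset.sum_add_distrib, List.length_append,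
    List.length_cons]
  omega

variable {R : Type*} [Group R] [DecidableEq R]

section Words

variable (q₀ q₁ σ : R)

/-- The automorphism named by a letter: `inl r` stands for `r ∈ R` and `inr s` for `φ(s)`. -/
def letterVal : R ⊕ R → TreeAut R := Sum.elim root (phi q₀ q₁ σ)

/-- The automorphism named by a word. -/
def wordVal (w : List (R ⊕ R)) : TreeAut R := (w.map (letterVal q₀ q₁ σ)).prod

/-- The action of a word on the first layer. -/
def wordRoot (w : List (R ⊕ R)) : R := (w.map (Sum.elim id 1)).prod

/-- The directed letters `s` of a word, each with the action on the first layer of the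
letters to the right of it. -/
def spikes : List (R ⊕ R) → List (R × R)
  | [] => []
  | Sum.inl _ :: w => spikes w
  | Sum.inr s :: w => (wordRoot w, s) :: spikes w

/-- The number of directed letters of a word. -/
def directedLength (w : List (R ⊕ R)) : ℕ := (spikes w).length

/-- The contribution of a directed letter to the section at `x`. -/
def sectLetter (x : R) (p : R × R) : R ⊕ R :=
  if p.1 * x = 1 then Sum.inr p.2 else Sum.inl (phiSection q₀ q₁ σ p.2 (p.1 * x))

/-- A word for the section at `x`. -/
def sectWord (w : List (R ⊕ R)) (x : R) : List (R ⊕ R) :=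
  (spikes w).map (sectLetter q₀ q₁ σ x)

/-- The `k`-th power of a word. -/
def wordPow (w : List (R ⊕ R)) : ℕ → List (R ⊕ R)
  | 0 => []
  | k + 1 => w ++ wordPow w k

variable {q₀ q₁ σ}

omit [DecidableEq R] in
theorem wordRoot_append (u w : List (R ⊕ R)) : wordRoot (u ++ w) = wordRoot u * wordRoot w := by
  simp [wordRoot]

theorem wordVal_append (u w : List (R ⊕ R)) :
    wordVal q₀ q₁ σ (u ++ w) = wordVal q₀ q₁ σ u * wordVal q₀ q₁ σ w := by
  simp [wordVal]

theorem wordVal_cons (l : R ⊕ R) (w : List (R ⊕ R)) :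
    wordVal q₀ q₁ σ (l :: w) = letterVal q₀ q₁ σ l * wordVal q₀ q₁ σ w := by
  simp [wordVal]

theorem wordVal_wordPow (w : List (R ⊕ R)) (k : ℕ) :
    wordVal q₀ q₁ σ (wordPow w k) = wordVal q₀ q₁ σ w ^ k := by
  induction k with
  | zero => rfl
  | succ k ih => rw [wordPow, wordVal_append, ih, pow_succ']

omit [DecidableEq R] in
theorem wordRoot_wordPow (w : List (R ⊕ R)) (k : ℕ) :
    wordRoot (wordPow w k) = wordRoot w ^ k := by
  induction k with
  | zero => simp [wordPow, wordRoot]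
  | succ k ih => rw [wordPow, wordRoot_append, ih, pow_succ']

omit [DecidableEq R] in
theorem spikes_append (u w : List (R ⊕ R)) :
    spikes (u ++ w) = (spikes u).map (fun p => (p.1 * wordRoot w, p.2)) ++ spikes w := by
  induction u with
  | nil => rfl
  | cons l u ih =>
    rcases l with r | s
    · exact ih
    · rw [List.cons_append, spikes, ih, wordRoot_append]; rfl

theorem wordVal_apply (w : List (R ⊕ R)) (x : R) :
    (wordVal q₀ q₁ σ w).1 [x] = [wordRoot w * x] := by
  induction w with
  | nil => simp [wordVal, wordRoot]
  | cons l w ih =>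
    rw [wordVal_cons]
    change (letterVal q₀ q₁ σ l).1 ((wordVal q₀ q₁ σ w).1 [x]) = _
    rw [ih]
    rcases l with r | s
    · change [r * (wordRoot w * x)] = _
      simp [wordRoot, mul_assoc]
    · change (phi q₀ q₁ σ s).1 [wordRoot w * x] = _
      rw [(isDirected_phi q₀ q₁ σ s).1]
      simp [wordRoot]

theorem sect_wordVal (w : List (R ⊕ R)) (x : R) :
    sect (wordVal q₀ q₁ σ w) [x] = wordVal q₀ q₁ σ (sectWord q₀ q₁ σ w x) := by
  induction w with
  | nil => exact sect_one _
  | cons l w ih =>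
    rw [wordVal_cons, sect_mul, wordVal_apply, ih]
    rcases l with r | s
    · change sect (root r) _ * _ = _
      rw [sect_root, one_mul]; rfl
    · change sect (phi q₀ q₁ σ s) _ * _ = wordVal q₀ q₁ σ (_ :: _)
      rw [wordVal_cons]
      congr 1
      by_cases h : wordRoot w * x = 1
      · simp [sectLetter, h, sect_phi_one, letterVal]
      · simp [sectLetter, h, sect_phi_ne _ _ _ _ h, letterVal]

theorem sectWord_wordPow_succ (w : List (R ⊕ R)) (k : ℕ) (x : R) :
    sectWord q₀ q₁ σ (wordPow w (k + 1)) x =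
      sectWord q₀ q₁ σ w (wordRoot w ^ k * x) ++ sectWord q₀ q₁ σ (wordPow w k) x := by
  simp only [sectWord, wordPow, spikes_append, List.map_append, List.map_map, wordRoot_wordPow]
  congr 1
  refine List.map_congr_left fun p _ => ?_
  simp [sectLetter, mul_assoc]

omit [DecidableEq R] in
theorem directedLength_append (u w : List (R ⊕ R)) :
    directedLength (u ++ w) = directedLength u + directedLength w := by
  simp [directedLength, spikes_append]

theorem directedLength_sectWord (w : List (R ⊕ R)) (x : R) :
    directedLength (sectWord q₀ q₁ σ w x) =
      (spikes w).countP (fun p => decide (p.1 * x = 1)) := by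
  unfold sectWord
  induction spikes w with
  | nil => rfl
  | cons p L ih =>
    rw [List.map_cons, ← List.singleton_append, directedLength_append, ih, List.countP_cons,
      add_comm]
    congr 1
    by_cases h : p.1 * x = 1 <;> simp [sectLetter, h, directedLength, spikes]

theorem directedLength_sectWord_wordPow (w : List (R ⊕ R)) (k : ℕ) (x : R) :
    directedLength (sectWord q₀ q₁ σ (wordPow w k) x) =
      ∑ j ∈ Finset.range k,
        (spikes w).countP (fun p => decide (p.1 * (wordRoot w ^ j * x) = 1)) := by
  induction k with
  | zero => rfl
  | succ k ih =>
    rw [sectWord_wordPow_succ, directedLength_append, ih, Finset.sum_range_succ, add_comm,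
      directedLength_sectWord]

omit [DecidableEq R] in
theorem pow_eq_of_mul_eq_one {r ρ x : R} {i j : ℕ} (hi : i < orderOf r) (hj : j < orderOf r)
    (h : ρ * (r ^ i * x) = 1) (h' : ρ * (r ^ j * x) = 1) : i = j := by
  refine pow_injOn_Iio_orderOf hi hj ?_
  have := mul_left_cancel (h.trans h'.symm)
  exact mul_right_cancel this

/-- A directed letter of w stays directed in the section at x only on the pass where the prefix to
its right brings x to 1. The points ρ^j x with j below the order of ρ are distinct, so this happens
on at most one pass. -/
theorem directedLength_sectWord_le (w : List (R ⊕ R)) (x : R) :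
    directedLength (sectWord q₀ q₁ σ (wordPow w (orderOf (wordRoot w))) x) ≤
      directedLength w := by
  rw [directedLength_sectWord_wordPow]
  exact sum_countP_le _ _ _ fun p i hi j hj h h' =>
    pow_eq_of_mul_eq_one hi hj (of_decide_eq_true h) (of_decide_eq_true h')

/-- A directed letter whose critical point misses the ρ-orbit of x becomes rooted on every pass. -/
theorem directedLength_sectWord_lt {w : List (R ⊕ R)} {x : R} {p : R × R} (hp : p ∈ spikes w)
    (h : ∀ j : ℕ, p.1 * (wordRoot w ^ j * x) ≠ 1) :
    directedLength (sectWord q₀ q₁ σ (wordPow w (orderOf (wordRoot w))) x) <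
      directedLength w := by
  rw [directedLength_sectWord_wordPow]
  exact sum_countP_lt _ _ _ (fun p i hi j hj h h' =>
    pow_eq_of_mul_eq_one hi hj (of_decide_eq_true h) (of_decide_eq_true h')) hp
    fun j _ => by simpa using h j

theorem mem_sectWord_wordPow {w : List (R ⊕ R)} {k : ℕ} {x : R} {l : R ⊕ R}
    (hl : l ∈ sectWord q₀ q₁ σ (wordPow w k) x) :
    ∃ p ∈ spikes w, ∃ j : ℕ, l = sectLetter q₀ q₁ σ (wordRoot w ^ j * x) p := by
  induction k with
  | zero => simp [sectWord, wordPow, spikes] at hl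
  | succ k ih =>
    rw [sectWord_wordPow_succ, List.mem_append] at hl
    rcases hl with hl | hl
    · obtain ⟨p, hp, rfl⟩ := List.mem_map.1 hl
      exact ⟨p, hp, k, rfl⟩
    · exact ih hl

/-- All rooted letters lie in `B` and all directed letters in `φ(A)`. -/
def LettersIn (A B : Subgroup R) (w : List (R ⊕ R)) : Prop :=
  (∀ r, Sum.inl r ∈ w → r ∈ B) ∧ ∀ s, Sum.inr s ∈ w → s ∈ A

omit [DecidableEq R] in
theorem LettersIn.wordRoot_mem {A B : Subgroup R} {w : List (R ⊕ R)} (h : LettersIn A B w) :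
    wordRoot w ∈ B := by
  refine list_prod_mem fun r hr => ?_
  obtain ⟨l, hl, rfl⟩ := List.mem_map.1 hr
  rcases l with r | s
  · exact h.1 r hl
  · exact B.one_mem

omit [DecidableEq R] in
theorem inr_mem_of_mem_spikes {w : List (R ⊕ R)} {p : R × R} (hp : p ∈ spikes w) :
    Sum.inr p.2 ∈ w := by
  induction w with
  | nil => simp [spikes] at hp
  | cons l w ih =>
    rcases l with r | s
    · exact List.mem_cons_of_mem _ (ih hp)
    · rcases List.mem_cons.1 hp with rfl | hp
      · exact List.mem_cons_self
      · exact List.mem_cons_of_mem _ (ih hp)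

theorem LettersIn.sectWord_wordPow {A B : Subgroup R} {w : List (R ⊕ R)} (h : LettersIn A B w)
    (k : ℕ) (x : R) : LettersIn A ⊤ (sectWord q₀ q₁ σ (wordPow w k) x) := by
  refine ⟨fun _ _ => trivial, fun s hs => ?_⟩
  obtain ⟨p, hp, j, hl⟩ := mem_sectWord_wordPow hs
  unfold sectLetter at hl
  split_ifs at hl
  rw [Sum.inr.inj hl]
  exact h.2 _ (inr_mem_of_mem_spikes hp)

variable [Finite R]

theorem isOfFinOrder_wordVal_of_sectWord {w : List (R ⊕ R)}
    (h : ∀ x, IsOfFinOrder (wordVal q₀ q₁ σ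
      (sectWord q₀ q₁ σ (wordPow w (orderOf (wordRoot w))) x))) :
    IsOfFinOrder (wordVal q₀ q₁ σ w) := by
  refine IsOfFinOrder.of_pow (n := orderOf (wordRoot w)) ?_ (orderOf_pos _).ne'
  rw [← wordVal_wordPow]
  have hf : FixesLetters (wordVal q₀ q₁ σ (wordPow w (orderOf (wordRoot w)))) := fun x => by
    rw [wordVal_apply, wordRoot_wordPow, pow_orderOf_eq_one, one_mul]
  rw [hf.eq_base]
  refine isOfFinOrder_base fun x => ?_
  rw [sect_wordVal]
  exact h x

theorem isOfFinOrder_wordVal_of_spikes_eq_nil {w : List (R ⊕ R)} (h : spikes w = []) :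
    IsOfFinOrder (wordVal q₀ q₁ σ w) := by
  refine isOfFinOrder_wordVal_of_sectWord fun x => ?_
  have : sectWord q₀ q₁ σ (wordPow w (orderOf (wordRoot w))) x = [] := by
    refine List.eq_nil_iff_forall_not_mem.2 fun l hl => ?_
    obtain ⟨p, hp, -⟩ := mem_sectWord_wordPow hl
    simp [h] at hp
  rw [this]
  exact IsOfFinOrder.one

/-- The induction step for words all of whose directed letters act in one coset of the cyclic
group generated by the action on the first layer. -/
theorem isOfFinOrder_wordVal_step {A B : Subgroup R} {w : List (R ⊕ R)} (hw : LettersIn A B w)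
    (ih : ∀ u, directedLength u < directedLength w → LettersIn A ⊤ u →
      IsOfFinOrder (wordVal q₀ q₁ σ u))
    (hcyc : ∀ r ∈ B, ∀ x : R, ∀ u, directedLength u ≤ directedLength w →
      (∀ l ∈ u, ∃ s ∈ A, l = Sum.inr s ∨
        ∃ y ∈ Subgroup.zpowers (x⁻¹ * r * x), y ≠ 1 ∧ l = Sum.inl (phiSection q₀ q₁ σ s y)) →
      IsOfFinOrder (wordVal q₀ q₁ σ u)) :
    IsOfFinOrder (wordVal q₀ q₁ σ w) := by
  rcases eq_or_ne (spikes w) [] with h0 | h0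
  · exact isOfFinOrder_wordVal_of_spikes_eq_nil h0
  -- If no orbit meets the critical points of all directed letters, every section is shorter and
  -- `ih` finishes.
  by_cases hfull : ∃ x, ∀ p ∈ spikes w, ∃ j : ℕ, p.1 * (wordRoot w ^ j * x) = 1
  · obtain ⟨x, hx⟩ := hfull
    -- Conjugation by x moves the base point of the full orbit to 1, so that the orbit becomes the
    -- cyclic group ⟨ρ⟩ generated by the new first-layer action.
    let u : List (R ⊕ R) := Sum.inl x⁻¹ :: (w ++ [Sum.inl x])
    have hval : wordVal q₀ q₁ σ u = (root x)⁻¹ * wordVal q₀ q₁ σ w * root x := by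
      simp [u, wordVal, letterVal, mul_assoc]
    have hroot : wordRoot u = x⁻¹ * wordRoot w * x := by simp [u, wordRoot, mul_assoc]
    have hspikes : spikes u = (spikes w).map fun p => (p.1 * x, p.2) := by
      simp [u, spikes, spikes_append, wordRoot]
    have hlen : directedLength u = directedLength w := by simp [directedLength, hspikes]
    have hcoset : ∀ p ∈ spikes u, p.1 ∈ Subgroup.zpowers (wordRoot u) := by
      rw [hspikes]
      intro p' hp'
      obtain ⟨p, hp, rfl⟩ := List.mem_map.1 hp'
      obtain ⟨j, hj⟩ := hx p hp
      have h1 : p.1 = x⁻¹ * (wordRoot w ^ j)⁻¹ := by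
        rw [mul_eq_one_iff_eq_inv.1 hj, mul_inv_rev]
      have h2 : p.1 * x = (wordRoot u ^ j)⁻¹ := by
        have := conj_pow (a := x⁻¹) (b := wordRoot w) (i := j)
        rw [inv_inv] at this
        rw [h1, hroot, this]; group
      change p.1 * x ∈ _
      rw [h2]
      exact inv_mem (pow_mem (Subgroup.mem_zpowers _) j)
    have hu : IsOfFinOrder (wordVal q₀ q₁ σ u) := by
      refine isOfFinOrder_wordVal_of_sectWord fun y => ?_
      have hA : ∀ p ∈ spikes u, p.2 ∈ A := by
        rw [hspikes]
        intro p' hp'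
        obtain ⟨p, hp, rfl⟩ := List.mem_map.1 hp'
        exact hw.2 p.2 (inr_mem_of_mem_spikes hp)
      -- For y in ⟨ρ⟩ all letters come from sections at elements of ⟨ρ⟩, the case covered by `hcyc`;
      -- for other y no directed letter survives.
      by_cases hy : y ∈ Subgroup.zpowers (wordRoot u)
      · refine hcyc (wordRoot w) hw.wordRoot_mem x _
          (hlen ▸ directedLength_sectWord_le u y) fun l hl => ?_
        obtain ⟨p, hp, j, rfl⟩ := mem_sectWord_wordPow hl
        refine ⟨p.2, hA p hp, ?_⟩
        unfold sectLetter
        split_ifs with h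
        · exact Or.inl rfl
        · refine Or.inr ⟨_, ?_, h, rfl⟩
          rw [← hroot]
          exact mul_mem (hcoset p hp) (mul_mem (pow_mem (Subgroup.mem_zpowers _) j) hy)
      · obtain ⟨p, hp⟩ := List.exists_mem_of_ne_nil (spikes u) (by simpa [hspikes] using h0)
        refine ih _ (hlen ▸ directedLength_sectWord_lt hp fun j hj => hy ?_) ?_
        · have h1 := mul_mem (inv_mem (pow_mem (Subgroup.mem_zpowers (wordRoot u)) j))
            (inv_mem (hcoset p hp))
          rwa [eq_inv_of_mul_eq_one_left hj, inv_inv, inv_mul_cancel_left] at h1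
        · have : LettersIn A ⊤ u := ⟨fun _ _ => trivial, fun s hs => hw.2 s (by simpa [u] using hs)⟩
          exact this.sectWord_wordPow _ _
    rw [hval] at hu
    have := (MulAut.conj (root x)).toMonoidHom.isOfFinOrder hu
    simpa [mul_assoc] using this
  · push Not at hfull
    refine isOfFinOrder_wordVal_of_sectWord fun x => ?_
    obtain ⟨p, hp, hpx⟩ := hfull x
    exact ih _ (directedLength_sectWord_lt hp hpx) (hw.sectWord_wordPow _ _)

/-- For a given length the step is used at most twice: from rooted letters in R to rooted letters in
`A` or A^σ, and from there to trivial rooted letters. In every other branch the length drops. -/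
theorem isOfFinOrder_wordVal_of_lettersIn {A : Subgroup R}
    (hA₀ : ∀ g, g⁻¹ * q₀ * g ∉ A) (hA₁ : ∀ g, g⁻¹ * q₁ * g ∉ A)
    (hcyc : ∀ r, q₀ ∈ Subgroup.zpowers r → q₁ ∉ Subgroup.zpowers r) (n : ℕ) :
    ∀ w, directedLength w ≤ n → LettersIn A ⊤ w → IsOfFinOrder (wordVal q₀ q₁ σ w) := by
  induction n using Nat.strong_induction_on with
  | _ n ih =>
  have hstep : ∀ B : Subgroup R, (∀ g, g⁻¹ * q₀ * g ∉ B) → (∀ g, g⁻¹ * q₁ * g ∉ B) →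
      ∀ w, directedLength w ≤ n → LettersIn A B w → IsOfFinOrder (wordVal q₀ q₁ σ w) := by
    intro B hB₀ hB₁ w hwn hw
    refine isOfFinOrder_wordVal_step hw
      (fun u hu hu' => ih _ (hu.trans_le hwn) u le_rfl hu') fun r hr x u _ hu => ?_
    have hmiss : ∀ y ∈ Subgroup.zpowers (x⁻¹ * r * x), x * y * x⁻¹ ∈ B := by
      rintro _ ⟨k, rfl⟩
      have := conj_zpow (a := x⁻¹) (b := r) (i := k)
      rw [inv_inv] at this
      simp only [this]
      have h2 : x * (x⁻¹ * r ^ k * x) * x⁻¹ = r ^ k := by group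
      rw [h2]; exact zpow_mem hr k
    have hq : ∀ q, (∀ g, g⁻¹ * q * g ∉ B) → ∀ y ∈ Subgroup.zpowers (x⁻¹ * r * x),
        ¬ (y = q ∨ y = q⁻¹) := by
      rintro q hq y hy (rfl | rfl)
      · exact hq x⁻¹ (by simpa using hmiss _ hy)
      · exact hq x⁻¹ (by simpa using hmiss _ (inv_mem hy))
    -- A cyclic group conjugate into `B` avoids q₀, q₁ and their inverses, so every rooted letter is
    -- trivial.
    have hmem : wordVal q₀ q₁ σ u ∈ (phi q₀ q₁ σ).range := by
      refine list_prod_mem fun g hg => ?_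
      obtain ⟨l, hl, rfl⟩ := List.mem_map.1 hg
      obtain ⟨s, -, rfl | ⟨y, hy, -, rfl⟩⟩ := hu l hl
      · exact ⟨s, rfl⟩
      · simp only [phiSection, hq q₀ hB₀ y hy, hq q₁ hB₁ y hy, if_false, letterVal,
          Sum.elim_inl, map_one]
        exact one_mem _
    obtain ⟨s, hs⟩ := hmem
    rw [← hs]
    exact MonoidHom.isOfFinOrder _ (isOfFinOrder_of_finite s)
  intro w hwn hw
  refine isOfFinOrder_wordVal_step hw
    (fun u hu hu' => ih _ (hu.trans_le hwn) u le_rfl hu') fun r _ x u hun hu => ?_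
  -- If q₁ is in the cyclic group, then q₀ is not and all rooted letters lie in A^σ. If q₁ is not,
  -- they all lie in `A`.
  by_cases h1 : q₁ ∈ Subgroup.zpowers (x⁻¹ * r * x)
  · have h0 : q₀ ∉ Subgroup.zpowers (x⁻¹ * r * x) := fun h0 => hcyc _ h0 h1
    have hconj : ∀ q, (∀ g, g⁻¹ * q * g ∉ A) →
        ∀ g, g⁻¹ * q * g ∉ A.map (MulAut.conj σ⁻¹).toMonoidHom := by
      rintro q hq g ⟨a, ha, h⟩
      refine hq (g * σ⁻¹) ?_
      have h' : σ⁻¹ * a * σ = g⁻¹ * q * g := by simpa using h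
      have : (g * σ⁻¹)⁻¹ * q * (g * σ⁻¹) = σ * (g⁻¹ * q * g) * σ⁻¹ := by group
      rw [this, ← h']
      have : σ * (σ⁻¹ * a * σ) * σ⁻¹ = a := by group
      rwa [this]
    refine hstep _ (hconj q₀ hA₀) (hconj q₁ hA₁) u (hun.trans hwn)
      ⟨fun c hc => ?_, fun s hs => ?_⟩
    · obtain ⟨s, hs, h | ⟨y, hy, -, h⟩⟩ := hu _ hc
      · cases h
      · rw [Sum.inl.inj h, phiSection, if_neg]
        · split_ifs
          · exact ⟨s, hs, by simp⟩
          · exact one_mem _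
        · rintro (rfl | rfl)
          · exact h0 hy
          · exact h0 (by simpa using inv_mem hy)
    · obtain ⟨s', hs', h | ⟨y, -, -, h⟩⟩ := hu _ hs
      · rwa [Sum.inr.inj h]
      · cases h
  · refine hstep A hA₀ hA₁ u (hun.trans hwn) ⟨fun c hc => ?_, fun s hs => ?_⟩
    · obtain ⟨s, hs, h | ⟨y, hy, -, h⟩⟩ := hu _ hc
      · cases h
      · rw [Sum.inl.inj h, phiSection]
        split_ifs with h2 h3
        · exact hs
        · rcases h3 with rfl | rfl
          · exact absurd hy h1
          · exact absurd (by simpa using inv_mem hy) h1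
        · exact one_mem _
    · obtain ⟨s', hs', h | ⟨y, -, -, h⟩⟩ := hu _ hs
      · rwa [Sum.inr.inj h]
      · cases h

omit [Finite R] in
theorem exists_word {A : Subgroup R} {g : TreeAut R}
    (hg : g ∈ spinalGroup (A.map (phi q₀ q₁ σ))) :
    ∃ w, LettersIn A ⊤ w ∧ wordVal q₀ q₁ σ w = g := by
  let K : Subgroup (TreeAut R) :=
    { carrier := {g | ∃ w, LettersIn A ⊤ w ∧ wordVal q₀ q₁ σ w = g}
      one_mem' := ⟨[], ⟨by simp, by simp⟩, rfl⟩
      mul_mem' := by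
        rintro _ _ ⟨u, hu, rfl⟩ ⟨w, hw, rfl⟩
        refine ⟨u ++ w, ⟨fun _ _ => trivial, fun s hs => ?_⟩, wordVal_append u w⟩
        exact (List.mem_append.1 hs).elim (hu.2 s) (hw.2 s)
      inv_mem' := by
        rintro _ ⟨w, hw, rfl⟩
        induction w with
        | nil => exact ⟨[], hw, by simp [wordVal]⟩
        | cons l w ih =>
          obtain ⟨u, hu, hu'⟩ := ih
            ⟨fun _ _ => trivial, fun s hs => hw.2 s (List.mem_cons_of_mem _ hs)⟩
          rcases l with r | s
          · refine ⟨u ++ [Sum.inl r⁻¹], ⟨fun _ _ => trivial, fun t ht => ?_⟩, ?_⟩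
            · exact hu.2 t (by simpa using ht)
            · rw [wordVal_append, hu', wordVal_cons, wordVal_cons, mul_inv_rev]
              simp [wordVal, letterVal]
          · refine ⟨u ++ [Sum.inr s⁻¹], ⟨fun _ _ => trivial, fun t ht => ?_⟩, ?_⟩
            · rcases List.mem_append.1 ht with ht | ht
              · exact hu.2 t ht
              · rw [Sum.inr.inj (List.mem_singleton.1 ht)]
                exact inv_mem (hw.2 s List.mem_cons_self)
            · rw [wordVal_append, hu', wordVal_cons, wordVal_cons, mul_inv_rev]
              simp [wordVal, letterVal] }
  refine spinalGroup_le (K := K) (fun r => ⟨[Sum.inl r], ⟨fun _ _ => trivial, by simp⟩, ?_⟩) ?_ hg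
  · simp [wordVal, letterVal]
  · rintro _ ⟨s, hs, rfl⟩
    refine ⟨[Sum.inr s], ⟨fun _ _ => trivial, fun t ht => ?_⟩, ?_⟩
    · rwa [Sum.inr.inj (List.mem_singleton.1 ht)]
    · simp [wordVal, letterVal]

theorem isPeriodic_phi {A : Subgroup R}
    (hA₀ : ∀ g, g⁻¹ * q₀ * g ∉ A) (hA₁ : ∀ g, g⁻¹ * q₁ * g ∉ A)
    (hcyc : ∀ r, q₀ ∈ Subgroup.zpowers r → q₁ ∉ Subgroup.zpowers r) :
    IsPeriodic (spinalGroup (A.map (phi q₀ q₁ σ))) := by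
  intro g
  obtain ⟨w, hw, h⟩ := exists_word g.2
  rw [← Submonoid.isOfFinOrder_coe]
  change IsOfFinOrder g.1
  rw [← h]
  exact isOfFinOrder_wordVal_of_lettersIn hA₀ hA₁ hcyc _ w le_rfl hw

end Words

end Periodic

/-! ### Short relations between two group elements. -/

section SmallWords

variable {G : Type*} [Group G]

theorem zpow_eq_one_of_inf_eq_bot {a b : G}
    (h : Subgroup.zpowers a ⊓ Subgroup.zpowers b = ⊥) {i j : ℤ} (hij : a ^ i = b ^ j) :
    a ^ i = 1 := by
  rw [← Subgroup.mem_bot, ← h]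
  exact ⟨⟨i, rfl⟩, ⟨j, hij.symm⟩⟩

set_option linter.unusedSimpArgs false in
-- A check of all coincidences x = ab⁻¹y with x and y in the five-element set. Apart from a = ab⁻¹b,
-- each one either makes a or b a power of the other, or gives a² = 1 or a² = b², or is one of the
-- relations excluded by `h5`, `h6`, `h7`, `h7'`.
theorem eq_of_mem_inter_translate {a b : G}
    (h : Subgroup.zpowers a ⊓ Subgroup.zpowers b = ⊥) (ha : a ^ 2 ≠ 1) (hb : b ^ 2 ≠ 1)
    (h5 : (a * b⁻¹) ^ 2 ≠ 1) (h6 : a ^ 2 * (a⁻¹ * b⁻¹ * a * b) ≠ 1)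
    (h7 : a⁻¹ * b * a ≠ b) (h7' : a⁻¹ * b * a ≠ b⁻¹) :
    ∀ x ∈ ({1, a, a⁻¹, b, b⁻¹} : Set G),
      (a * b⁻¹)⁻¹ * x ∈ ({1, a, a⁻¹, b, b⁻¹} : Set G) → x = a := by
  have ha1 : a ≠ 1 := by rintro rfl; simp at ha
  have hb1 : b ≠ 1 := by rintro rfl; simp at hb
  have hab : ∀ j : ℤ, a ≠ b ^ j := fun j hj => ha1 <| by
    simpa using zpow_eq_one_of_inf_eq_bot (i := 1) h (by simpa using hj)
  have hba : ∀ j : ℤ, b ≠ a ^ j := fun j hj => hb1 <| by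
    rw [inf_comm] at h
    simpa using zpow_eq_one_of_inf_eq_bot (i := 1) h (by simpa using hj)
  have hab2 : a ^ 2 ≠ b ^ 2 := fun h' => ha <| by
    exact_mod_cast zpow_eq_one_of_inf_eq_bot (i := 2) (j := 2) h (by exact_mod_cast h')
  simp only [Set.mem_insert_iff, Set.mem_singleton_iff]
  rintro x (rfl | rfl | rfl | rfl | rfl) H
  · exfalso
    rcases H with H | H | H | H | H
    · exact hba 1 (by calc b = (a * b⁻¹)⁻¹ * 1 * a := by simp [pow_succ, mul_assoc]
        _ = _ := by rw [H]; simp [zpow_ofNat, pow_succ, mul_assoc])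
    · exact hba 2 (by calc b = (a * b⁻¹)⁻¹ * 1 * a := by simp [pow_succ, mul_assoc]
        _ = _ := by rw [H]; simp [zpow_ofNat, pow_succ, mul_assoc])
    · exact hba 0 (by calc b = (a * b⁻¹)⁻¹ * 1 * a := by simp [pow_succ, mul_assoc]
        _ = _ := by rw [H]; simp [zpow_ofNat, pow_succ, mul_assoc])
    · exact hab 0 (by calc a = ((a * b⁻¹)⁻¹ * 1)⁻¹ * b := by simp [pow_succ, mul_assoc]
        _ = _ := by rw [H]; simp [zpow_ofNat, pow_succ, mul_assoc])
    · exact hab 2 (by calc a = ((a * b⁻¹)⁻¹ * 1)⁻¹ * b := by simp [pow_succ, mul_assoc]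
        _ = _ := by rw [H]; simp [zpow_ofNat, pow_succ, mul_assoc])
  · rfl
  · exfalso
    rcases H with H | H | H | H | H
    · exact hba 2 (by calc b = (a * b⁻¹)⁻¹ * a⁻¹ * a * a := by simp [pow_succ, mul_assoc]
        _ = _ := by rw [H]; simp [zpow_ofNat, pow_succ, mul_assoc])
    · exact hba 3 (by calc b = (a * b⁻¹)⁻¹ * a⁻¹ * a * a := by simp [pow_succ, mul_assoc]
        _ = _ := by rw [H]; simp [zpow_ofNat, pow_succ, mul_assoc])
    · exact hba 1 (by calc b = (a * b⁻¹)⁻¹ * a⁻¹ * a * a := by simp [pow_succ, mul_assoc]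
        _ = _ := by rw [H]; simp [zpow_ofNat, pow_succ, mul_assoc])
    · exact ha (by calc a ^ 2 = ((a * b⁻¹)⁻¹ * a⁻¹)⁻¹ * b := by simp [pow_succ, mul_assoc]
        _ = _ := by rw [H]; simp [zpow_ofNat, pow_succ, mul_assoc])
    · exact hab2 (by calc a ^ 2 = ((a * b⁻¹)⁻¹ * a⁻¹)⁻¹ * b := by simp [pow_succ, mul_assoc]
        _ = _ := by rw [H]; simp [zpow_ofNat, pow_succ, mul_assoc])
  · exfalso
    rcases H with H | H | H | H | H
    · exact hab 2 (by calc a = x * ((a * x⁻¹)⁻¹ * x)⁻¹ * x := by simp [pow_succ, mul_assoc]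
        _ = _ := by rw [H]; simp [zpow_ofNat, pow_succ, mul_assoc])
    · exact h5 (by calc (a * x⁻¹) ^ 2 = (((a * x⁻¹)⁻¹ * x) * a⁻¹)⁻¹ := by simp [pow_succ, mul_assoc]
        _ = _ := by rw [H]; simp [zpow_ofNat, pow_succ, mul_assoc])
    · exact h7' (by calc a⁻¹ * x * a = x⁻¹ * ((x * a⁻¹ * x) * a) := by simp [pow_succ, mul_assoc]
        _ = x⁻¹ * (((a * x⁻¹)⁻¹ * x) * a) := by simp [pow_succ, mul_assoc]
        _ = _ := by rw [H]; simp [zpow_ofNat, pow_succ, mul_assoc])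
    · exact hab 1 (by calc a = x * ((a * x⁻¹)⁻¹ * x)⁻¹ * x := by simp [pow_succ, mul_assoc]
        _ = _ := by rw [H]; simp [zpow_ofNat, pow_succ, mul_assoc])
    · exact hab 3 (by calc a = x * ((a * x⁻¹)⁻¹ * x)⁻¹ * x := by simp [pow_succ, mul_assoc]
        _ = _ := by rw [H]; simp [zpow_ofNat, pow_succ, mul_assoc])
  · exfalso
    rcases H with H | H | H | H | H
    · exact hab 0 (by calc a = b⁻¹ * ((a * b⁻¹)⁻¹ * b⁻¹)⁻¹ * b := by simp [pow_succ, mul_assoc]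
        _ = _ := by rw [H]; simp [zpow_ofNat, pow_succ, mul_assoc])
    · exact h6 (by calc a ^ 2 * (a⁻¹ * b⁻¹ * a * b) = a * (b⁻¹ * a * b) := by simp [pow_succ, mul_assoc]
        _ = a * (b⁻¹ * ((a * b⁻¹)⁻¹ * b⁻¹) * b) := by rw [H]
        _ = _ := by simp [pow_succ, mul_assoc])
    · exact h7 (by calc a⁻¹ * b * a = ((a * b⁻¹)⁻¹ * b⁻¹) * b * a := by rw [H]
        _ = _ := by simp [pow_succ, mul_assoc])
    · exact hab (-1) (by calc a = b⁻¹ * ((a * b⁻¹)⁻¹ * b⁻¹)⁻¹ * b := by simp [pow_succ, mul_assoc]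
        _ = _ := by rw [H]; simp [zpow_ofNat, pow_succ, mul_assoc])
    · exact hab 1 (by calc a = b⁻¹ * ((a * b⁻¹)⁻¹ * b⁻¹)⁻¹ * b := by simp [pow_succ, mul_assoc]
        _ = _ := by rw [H]; simp [zpow_ofNat, pow_succ, mul_assoc])

end SmallWords

/-! ### Alternating groups on initial segments. -/

section Alternating

variable {m : ℕ}

/-- The three-cycle `(i l j)`. -/
def threeCycle {i j l : Fin m} (hil : i ≠ l) (hjl : j ≠ l) : Alt m :=
  ⟨Equiv.swap j l * Equiv.swap i l, by
    rw [Equiv.Perm.mem_alternatingGroup, Equiv.Perm.sign_mul, Equiv.Perm.sign_swap hil,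
      Equiv.Perm.sign_swap hjl]; rfl⟩

theorem threeCycle_apply {i j l : Fin m} (hil : i ≠ l) (hjl : j ≠ l) :
    (threeCycle hil hjl).1 i = j := by
  simp [threeCycle]

theorem threeCycle_apply_of_ne {i j l : Fin m} (hil : i ≠ l) (hjl : j ≠ l) {x : Fin m}
    (h1 : x ≠ i) (h2 : x ≠ j) (h3 : x ≠ l) : (threeCycle hil hjl).1 x = x := by
  simp [threeCycle, Equiv.swap_apply_of_ne_of_ne, h1, h2, h3]

theorem altSub_mono {k k' : ℕ} (h : k ≤ k') : altSub m k ≤ altSub m k' :=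
  fun _ hg i hi => hg i (h.trans hi)

theorem altSub_self : altSub m m = ⊤ :=
  eq_top_iff.2 fun _ _ i hi => absurd i.2 (not_lt.2 hi)

theorem exists_mem_altSub_apply {k : ℕ} (hk : 3 ≤ k) (hkm : k ≤ m) {i j : Fin m} (hi : i.1 < k)
    (hj : j.1 < k) : ∃ h ∈ altSub m k, h.1 i = j := by
  obtain ⟨l, hl, hil, hjl⟩ : ∃ l : Fin m, l.1 < k ∧ i ≠ l ∧ j ≠ l := by
    have : ∃ l < 3, i.1 ≠ l ∧ j.1 ≠ l := by
      by_cases h0 : i.1 ≠ 0 ∧ j.1 ≠ 0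
      · exact ⟨0, by omega, h0⟩
      · by_cases h1 : i.1 ≠ 1 ∧ j.1 ≠ 1
        · exact ⟨1, by omega, h1⟩
        · exact ⟨2, by omega, by omega, by omega⟩
    obtain ⟨l, hl, h1, h2⟩ := this
    exact ⟨⟨l, by omega⟩, by simp only; omega, fun h => h1 (by rw [h]), fun h => h2 (by rw [h])⟩
  refine ⟨threeCycle hil hjl, fun x hx => ?_, threeCycle_apply hil hjl⟩
  refine threeCycle_apply_of_ne hil hjl ?_ ?_ ?_ <;> rintro rfl <;> omega

/-- Alt(k) is the stabiliser of the point k in Alt(k+1) and is transitive on the other points. So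
one element s moving k suffices: each g moving k agrees at k with some hs, h ∈ Alt(k), and differs
from it by an element of Alt(k). -/
theorem altSub_succ_le {k : ℕ} (hk : 3 ≤ k) (hkm : k < m) {K : Subgroup (Alt m)}
    (hK : altSub m k ≤ K) {s : Alt m} (hs : s ∈ altSub m (k + 1)) (hsK : s ∈ K)
    (hsk : s.1 ⟨k, hkm⟩ ≠ ⟨k, hkm⟩) : altSub m (k + 1) ≤ K := by
  have hlt : ∀ g ∈ altSub m (k + 1), g.1 ⟨k, hkm⟩ ≠ ⟨k, hkm⟩ → (g.1 ⟨k, hkm⟩).1 < k := by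
    intro g hg hgk
    by_contra hge
    have h1 : (g.1 ⟨k, hkm⟩).1 ≠ k := fun h => hgk (Fin.ext h)
    have h2 := hg (g.1 ⟨k, hkm⟩) (by omega)
    exact hgk (g.1.injective h2)
  have hfix : ∀ g ∈ altSub m (k + 1), g.1 ⟨k, hkm⟩ = ⟨k, hkm⟩ → g ∈ altSub m k := by
    intro g hg hgk i hi
    rcases hi.eq_or_lt with h | h
    · have : i = ⟨k, hkm⟩ := Fin.ext h.symm
      rw [this, hgk]
    · exact hg i h
  intro g hg
  by_cases hgk : g.1 ⟨k, hkm⟩ = ⟨k, hkm⟩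
  · exact hK (hfix g hg hgk)
  · obtain ⟨h, hh, hh'⟩ := exists_mem_altSub_apply hk hkm.le (hlt s hs hsk) (hlt g hg hgk)
    have h1 : h * s ∈ K := K.mul_mem (hK hh) hsK
    refine (K.mul_mem_cancel_left (K.inv_mem h1)).1 (hK (hfix _ ?_ ?_))
    · exact mul_mem (inv_mem (mul_mem (altSub_mono k.le_succ hh) hs)) hg
    · change (h.1 * s.1)⁻¹ (g.1 ⟨k, hkm⟩) = _
      rw [Equiv.Perm.inv_eq_iff_eq, ← hh']; rfl

/-- Conjugating an element t of Alt(k) with t(0) = 1 by some s with s(0) = k produces an element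
that moves k. -/
theorem altSub_succ_le_of_conj_mem {k : ℕ} (hk : 3 ≤ k) (hkm : k < m) {K : Subgroup (Alt m)}
    (hK : altSub m k ≤ K) (hconj : ∀ s ∈ altSub m (k + 1), ∀ t ∈ K, s * t * s⁻¹ ∈ K) :
    altSub m (k + 1) ≤ K := by
  obtain ⟨s, hs, hs'⟩ := exists_mem_altSub_apply (k := k + 1) (by omega) hkm
    (i := ⟨0, by omega⟩) (j := ⟨k, hkm⟩) (by simp) (by simp)
  obtain ⟨t, ht, ht'⟩ := exists_mem_altSub_apply hk hkm.le
    (i := ⟨0, by omega⟩) (j := ⟨1, by omega⟩) (by simp only; omega) (by simp only; omega)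
  refine altSub_succ_le hk hkm hK (s := s * t * s⁻¹)
    (mul_mem (mul_mem hs (altSub_mono k.le_succ ht)) (inv_mem hs)) (hconj s hs t (hK ht)) ?_
  have h1 : s.1⁻¹ ⟨k, hkm⟩ = ⟨0, by omega⟩ := by rw [Equiv.Perm.inv_eq_iff_eq, hs']
  change s.1 (t.1 (s.1⁻¹ ⟨k, hkm⟩)) ≠ ⟨k, hkm⟩
  rw [h1, ht', ← hs']
  intro h
  have := congrArg Fin.val (s.1.injective h)
  simp at this

theorem altSub_ne_bot {k : ℕ} (hk : 3 ≤ k) (hkm : k ≤ m) : altSub m k ≠ ⊥ := by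
  obtain ⟨t, ht, ht'⟩ := exists_mem_altSub_apply hk hkm
    (i := ⟨0, by omega⟩) (j := ⟨1, by omega⟩) (by simp only; omega) (by simp only; omega)
  intro h
  rw [h, Subgroup.mem_bot] at ht
  subst ht
  simpa using congrArg Fin.val ht'

theorem exists_mem_altSub_succ_notMem {k : ℕ} (hk : 3 ≤ k) (hkm : k < m) :
    ∃ s ∈ altSub m (k + 1), s ∉ altSub m k := by
  obtain ⟨s, hs, hs'⟩ := exists_mem_altSub_apply (k := k + 1) (by omega) hkm
    (i := ⟨k, hkm⟩) (j := ⟨0, by omega⟩) (by simp) (by simp)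
  refine ⟨s, hs, fun h => ?_⟩
  have := congrArg Fin.val ((h ⟨k, hkm⟩ le_rfl).symm.trans hs')
  simp only at this
  omega

theorem altSub_ne_top {k : ℕ} (hk : 3 ≤ k) (hkm : k < m) : altSub m k ≠ ⊤ := fun h => by
  obtain ⟨s, -, hs⟩ := exists_mem_altSub_succ_notMem hk hkm
  exact hs (h ▸ Subgroup.mem_top s)

end Alternating

/-! ### Specialisation to R = Alt(n+2). -/

section Main

variable {n : ℕ} {q₀ q₁ σ : Alt (n + 2)}

theorem Admissible.q₀_sq_ne_one (h : Admissible n q₀ q₁ σ) : q₀ ^ 2 ≠ 1 := fun h2 =>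
  absurd h.two_lt_order₀ (not_lt.2 (orderOf_le_of_pow_eq_one two_pos h2))

theorem Admissible.q₁_sq_ne_one (h : Admissible n q₀ q₁ σ) : q₁ ^ 2 ≠ 1 := fun h2 =>
  absurd h.two_lt_order₁ (not_lt.2 (orderOf_le_of_pow_eq_one two_pos h2))

theorem Admissible.q₀_ne_one (h : Admissible n q₀ q₁ σ) : q₀ ≠ 1 := fun h1 =>
  h.q₀_sq_ne_one (by rw [h1, one_pow])

theorem Admissible.q₁_ne_one (h : Admissible n q₀ q₁ σ) : q₁ ≠ 1 := fun h1 =>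
  h.q₁_sq_ne_one (by rw [h1, one_pow])

theorem Admissible.notMem_zpowers (h : Admissible n q₀ q₁ σ) (r : Alt (n + 2))
    (h0 : q₀ ∈ Subgroup.zpowers r) : q₁ ∉ Subgroup.zpowers r := fun h1 =>
  h.not_common_power r q₀ q₁ h0 h1 ⟨IsConj.refl _, IsConj.refl _⟩

theorem Admissible.q₁_ne_q₀ (h : Admissible n q₀ q₁ σ) : q₁ ≠ q₀ := fun h' =>
  h.notMem_zpowers q₀ (Subgroup.mem_zpowers _) (h' ▸ Subgroup.mem_zpowers _)

theorem Admissible.q₁_ne_q₀_inv (h : Admissible n q₀ q₁ σ) : q₁ ≠ q₀⁻¹ := fun h' =>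
  h.notMem_zpowers q₀ (Subgroup.mem_zpowers _) (h' ▸ inv_mem (Subgroup.mem_zpowers _))

theorem Admissible.conjGenerates (h : Admissible n q₀ q₁ σ) {k : ℕ} (hk : n ≤ k) :
    ConjGenerates (altSub (n + 2) k) σ :=
  top_le_iff.1 (h.generate.symm.trans_le
    (sup_le_sup (altSub_mono hk) (Subgroup.map_mono (altSub_mono hk))))

theorem Admissible.isConstantSpinal (h : Admissible n q₀ q₁ σ) {k : ℕ} (hk : n ≤ k) :
    IsConstantSpinal (spinalGroup (directedAlt n q₀ q₁ σ k)) (directedAlt n q₀ q₁ σ k) :=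
  isConstantSpinal_phi h.q₀_ne_one h.q₁_ne_one h.q₁_ne_q₀ h.q₁_ne_q₀_inv (h.conjGenerates hk)

theorem Admissible.geometricPower_le (h : Admissible n q₀ q₁ σ) (hn : 5 ≤ n) {k : ℕ}
    (hk : n ≤ k) (hk' : k < n + 2) :
    geometricPower (spinalGroup (directedAlt n q₀ q₁ σ k)) ≤
      spinalGroup (directedAlt n q₀ q₁ σ k) := by
  have : IsSimpleGroup (Alt (n + 2)) := by
    refine alternatingGroup.isSimpleGroup ?_
    simp; omega
  exact geometricPower_phi_le h.q₀_ne_one h.q₁_ne_one h.q₁_ne_q₀ h.q₁_ne_q₀_inv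
    (eq_of_mem_inter_translate h.inf_zpowers h.q₀_sq_ne_one h.q₁_sq_ne_one h.mul_inv_sq
      h.sq_mul_comm h.conj_ne h.conj_ne_inv)
    (h.conjGenerates hk) (altSub_ne_bot (by omega) hk'.le) (altSub_ne_top (by omega) hk')

theorem Admissible.isMaximalOfInfiniteIndex (h : Admissible n q₀ q₁ σ) (hn : 5 ≤ n) :
    IsMaximalOfInfiniteIndex (spinalGroup (directedAlt n q₀ q₁ σ n))
      (spinalGroup (directedAlt n q₀ q₁ σ (n + 1))) := by
  have : Nontrivial (Alt (n + 2)) := ⟨_, _, h.q₀_ne_one⟩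
  refine isMaximalOfInfiniteIndex_spinalGroup isDirected_of_mem_map_phi
    (Subgroup.map_mono (altSub_mono n.le_succ)) ?_ (h.geometricPower_le hn (by omega) (by omega))
    (h.geometricPower_le hn le_rfl (by omega)) ?_ ?_
  · intro hle
    obtain ⟨s, hs, hs'⟩ := exists_mem_altSub_succ_notMem (m := n + 2) (k := n) (by omega) (by omega)
    obtain ⟨t, ht, hts⟩ := hle ⟨s, hs, rfl⟩
    exact hs' (phi_injective h.q₀_ne_one hts ▸ ht)
  · rintro K hTK _ ⟨s, hs, rfl⟩ hsK hsT
    refine Subgroup.map_le_iff_le_comap.2 (altSub_succ_le (by omega) (by omega)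
      (Subgroup.map_le_iff_le_comap.1 hTK) hs hsK fun hfix => hsT ⟨s, fun i hi => ?_, rfl⟩)
    rcases hi.eq_or_lt with h' | h'
    · rw [show i = ⟨n, by omega⟩ from Fin.ext h'.symm]; exact hfix
    · exact hs i h'
  · intro K hTK hK
    refine Subgroup.map_le_iff_le_comap.2 (altSub_succ_le_of_conj_mem (by omega) (by omega)
      (Subgroup.map_le_iff_le_comap.1 hTK) fun s hs t ht => ?_)
    rw [Subgroup.mem_comap, map_mul, map_mul, map_inv]
    exact hK _ ⟨s, hs, rfl⟩ _ ht

theorem IsMaximalOfInfiniteIndex.not_isMF {A : Type*} [Group A] {H G : Subgroup A}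
    (h : IsMaximalOfInfiniteIndex H G) : ¬ IsMF G := fun hMF =>
  h.2.2 (hMF _ h.2.1)

theorem isSpecial_spinalGroup {R : Type*} [Group R] {T D : Subgroup (TreeAut R)} (hTD : T ≤ D) :
    IsSpecial (spinalGroup T) (spinalGroup D) D := by
  refine ⟨T, hTD, 1, one_mem _, ?_⟩
  rw [map_one]
  exact (Subgroup.map_id _).symm

theorem Admissible.isLayered (h : Admissible n q₀ q₁ σ) (hn : 5 ≤ n) {k : ℕ}
    (hk : n ≤ k) (hk' : k < n + 2) : IsLayered (spinalGroup (directedAlt n q₀ q₁ σ k)) :=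
  isLayered_spinalGroup isDirected_of_mem_map_phi (h.geometricPower_le hn hk hk')

theorem Admissible.isPeriodic (h : Admissible n q₀ q₁ σ) :
    IsPeriodic (spinalGroup (directedAlt n q₀ q₁ σ (n + 1))) :=
  isPeriodic_phi h.conj_notMem₀ h.conj_notMem₁ h.notMem_zpowers

end Main

/-! ### Existence of admissible q₀, q₁, σ. -/

section Existence

variable {n : ℕ}

theorem perm_inv_apply_self {α : Type*} (f : Equiv.Perm α) (x : α) : f⁻¹ (f x) = x :=
  f.symm_apply_apply x

/-- Take σ = (0 n)(1 n+1). Then Alt(n)^σ consists of the even permutations fixing 0 and 1, so it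
contains three-cycles on {n, 2, 3} and on {n+1, 2, 3}. Adjoining these to Alt(n) gives Alt(n+1) and
then Alt(n+2). -/
theorem exists_conjGenerates (hn : 5 ≤ n) :
    ∃ σ : Alt (n + 2), altSub (n + 2) n ⊔
      (altSub (n + 2) n).map (MulAut.conj σ⁻¹).toMonoidHom = ⊤ := by
  let p (k : ℕ) (hk : k < n + 2) : Fin (n + 2) := ⟨k, hk⟩
  have hp : ∀ {j k hj hk}, j ≠ k → p j hj ≠ p k hk := fun h h' => h (congrArg Fin.val h')
  have h0 : 0 < n + 2 := by omega
  have h1 : 1 < n + 2 := by omega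
  have h2 : 2 < n + 2 := by omega
  have h3 : 3 < n + 2 := by omega
  have hn0 : n < n + 2 := by omega
  have hn1 : n + 1 < n + 2 := by omega
  let σ : Alt (n + 2) := ⟨Equiv.swap (p 0 h0) (p n hn0) * Equiv.swap (p 1 h1) (p (n + 1) hn1), by
    rw [Equiv.Perm.mem_alternatingGroup, Equiv.Perm.sign_mul,
      Equiv.Perm.sign_swap (hp (by omega)), Equiv.Perm.sign_swap (hp (by omega))]; rfl⟩
  have hσ0 : σ.1 (p 0 h0) = p n hn0 := by
    change Equiv.swap (p 0 h0) (p n hn0) (Equiv.swap (p 1 h1) (p (n + 1) hn1) (p 0 h0)) = p n hn0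
    rw [Equiv.swap_apply_of_ne_of_ne (hp (by omega) : p 0 h0 ≠ p 1 h1) (hp (by omega)),
      Equiv.swap_apply_left]
  have hσ1 : σ.1 (p 1 h1) = p (n + 1) hn1 := by
    change Equiv.swap (p 0 h0) (p n hn0) (Equiv.swap (p 1 h1) (p (n + 1) hn1) (p 1 h1)) = p (n + 1) hn1
    rw [Equiv.swap_apply_left, Equiv.swap_apply_of_ne_of_ne (hp (by omega)) (hp (by omega))]
  refine ⟨σ, ?_⟩
  set K := altSub (n + 2) n ⊔ (altSub (n + 2) n).map (MulAut.conj σ⁻¹).toMonoidHom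
  have hK : altSub (n + 2) n ≤ K := le_sup_left
  have hfix : ∀ t : Alt (n + 2), t.1 (p 0 h0) = p 0 h0 → t.1 (p 1 h1) = p 1 h1 → t ∈ K := by
    intro t ht0 ht1
    refine (le_sup_right : _ ≤ K) ⟨σ * t * σ⁻¹, fun i hi => ?_, by simp [mul_assoc]⟩
    change σ.1 (t.1 (σ.1⁻¹ i)) = i
    obtain hi | hi : i = p n hn0 ∨ i = p (n + 1) hn1 := by
      have := i.2
      rcases (show i.1 = n ∨ i.1 = n + 1 by omega) with h | h
      · exact Or.inl (Fin.ext h)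
      · exact Or.inr (Fin.ext h)
    · rw [hi, ← hσ0, perm_inv_apply_self, ht0]
    · rw [hi, ← hσ1, perm_inv_apply_self, ht1]
  have hK1 : altSub (n + 2) (n + 1) ≤ K := by
    let s : Alt (n + 2) := threeCycle (i := p n hn0) (j := p 3 h3) (l := p 2 h2)
      (hp (by omega)) (hp (by omega))
    refine altSub_succ_le (by omega) hn0 hK (s := s) (fun i hi => ?_) (hfix s ?_ ?_) ?_
    · refine threeCycle_apply_of_ne _ _ ?_ ?_ ?_ <;> rintro rfl <;> simp only [p] at hi <;> omega
    · exact threeCycle_apply_of_ne _ _ (hp (by omega)) (hp (by omega)) (hp (by omega))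
    · exact threeCycle_apply_of_ne _ _ (hp (by omega)) (hp (by omega)) (hp (by omega))
    · exact (threeCycle_apply _ _).trans_ne (hp (by omega))
  let s : Alt (n + 2) := threeCycle (i := p (n + 1) hn1) (j := p 3 h3) (l := p 2 h2)
    (hp (by omega)) (hp (by omega))
  rw [← top_le_iff, ← altSub_self]
  refine altSub_succ_le (by omega) hn1 hK1 (s := s) (altSub_self.symm ▸ Subgroup.mem_top s)
    (hfix s ?_ ?_) ?_
  · exact threeCycle_apply_of_ne _ _ (hp (by omega)) (hp (by omega)) (hp (by omega))
  · exact threeCycle_apply_of_ne _ _ (hp (by omega)) (hp (by omega)) (hp (by omega))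
  · exact (threeCycle_apply _ _).trans_ne (hp (by omega))

theorem two_lt_orderOf_of_apply_ne {α : Type*} [Finite α] {G : Subgroup (Equiv.Perm α)} {q : G}
    {x : α} (h : q.1 (q.1 x) ≠ x) : 2 < orderOf q := by
  have h0 := orderOf_pos q
  by_contra hle
  have h2 : q ^ 2 = 1 := by
    rw [← orderOf_dvd_iff_pow_eq_one]
    interval_cases orderOf q <;> decide
  exact h (by
    have := congrArg (fun g : G => g.1 x) h2
    simpa [pow_two] using this)

/-- Alt(n+1) is the stabiliser of the last point, and conjugates of q have no fixed points either.
-/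
theorem notMem_altSub_of_forall_apply_ne {q : Alt (n + 2)} (h : ∀ x, q.1 x ≠ x)
    (g : Alt (n + 2)) : g⁻¹ * q * g ∉ altSub (n + 2) (n + 1) := by
  intro hg
  have h1 := hg ⟨n + 1, by omega⟩ le_rfl
  change g.1⁻¹ (q.1 (g.1 _)) = _ at h1
  rw [Equiv.Perm.inv_eq_iff_eq] at h1
  exact h _ h1

theorem zpow_apply_eq_self {α : Type*} {f : Equiv.Perm α} {x : α} (h : f x = x) (i : ℤ) :
    (f ^ i) x = x :=
  Equiv.Perm.zpow_apply_eq_self_of_apply_eq_self h i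

/-- A common power z commutes with both permutations, so its fixed-point set is invariant under
both. It contains a, because z² and z^m fix a with m odd; by transitivity z is trivial. -/
theorem zpowers_inf_eq_bot {α : Type*} {q₀ q₁ : Equiv.Perm α} {a : α} {m : ℕ}
    (ha : q₀ (q₀ a) = a) (hm : Odd m) (hqm : (q₁ ^ m) a = a)
    (htrans : ∀ s : Set α, a ∈ s → (∀ x ∈ s, q₀ x ∈ s) → (∀ x ∈ s, q₁ x ∈ s) → ∀ x, x ∈ s) :
    Subgroup.zpowers q₀ ⊓ Subgroup.zpowers q₁ = ⊥ := by
  refine (Subgroup.eq_bot_iff_forall _).2 ?_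
  rintro z ⟨⟨i, hi⟩, ⟨j, hj⟩⟩
  have hz0 : Commute z q₀ := hi ▸ (Commute.refl q₀).zpow_left i
  have hz1 : Commute z q₁ := hj ▸ (Commute.refl q₁).zpow_left j
  have h2 : (z ^ 2) a = a := by
    have : z ^ 2 = (q₀ ^ 2) ^ i := by
      rw [← hi]; simp only [← zpow_natCast, ← zpow_mul, mul_comm]
    rw [this]
    exact zpow_apply_eq_self (by simpa [pow_two] using ha) i
  have hzm : (z ^ m) a = a := by
    have : z ^ m = (q₁ ^ m) ^ j := by
      rw [← hj]; simp only [← zpow_natCast, ← zpow_mul, mul_comm]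
    rw [this]
    exact zpow_apply_eq_self hqm j
  have hza : z a = a := by
    obtain ⟨k, rfl⟩ := hm
    rw [pow_succ', pow_mul, Equiv.Perm.mul_apply] at hzm
    have h3 : ((z ^ 2) ^ k) a = a := by
      simpa using zpow_apply_eq_self h2 (k : ℤ)
    rwa [h3] at hzm
  ext x
  refine htrans {x | z x = x} hza (fun x hx => ?_) (fun x hx => ?_) x
  · change (z * q₀) x = q₀ x
    rw [hz0.eq, Equiv.Perm.mul_apply, hx]
  · change (z * q₁) x = q₁ x
    rw [hz1.eq, Equiv.Perm.mul_apply, hx]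

/-- Each inequality of group elements is witnessed at one point. In `h5` and `h6` the auxiliary w is
q₁⁻¹q₀z and q₁⁻¹q₀q₁x, which avoids computing q₁⁻¹. `hcomm` gives the condition on cyclic subgroups,
because these are abelian. -/
theorem Admissible.of_apply {q₀ q₁ σ : Alt (n + 2)} {a : Fin (n + 2)} {m : ℕ}
    (f0 : ∀ x, q₀.1 x ≠ x) (f1 : ∀ x, q₁.1 x ≠ x)
    (t0 : ∃ x, q₀.1 (q₀.1 x) ≠ x) (t1 : ∃ x, q₁.1 (q₁.1 x) ≠ x)
    (ha : q₀.1 (q₀.1 a) = a) (hm : Odd m) (hqm : (q₁.1 ^ m) a = a)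
    (htrans : ∀ s : Set (Fin (n + 2)), a ∈ s → (∀ x ∈ s, q₀.1 x ∈ s) → (∀ x ∈ s, q₁.1 x ∈ s) →
      ∀ x, x ∈ s)
    (hcomm : ∀ k : Alt (n + 2), ¬ Commute q₀ (k * q₁ * k⁻¹))
    (h5 : ∃ z w, q₁.1 w = q₀.1 z ∧ q₀.1 w ≠ q₁.1 z)
    (h6 : ∃ x w, q₁.1 w = q₀.1 (q₁.1 x) ∧ q₀.1 w ≠ x)
    (h7 : ∃ x, q₁.1 (q₀.1 x) ≠ q₀.1 (q₁.1 x))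
    (h7' : ∃ x, q₁.1 (q₀.1 (q₁.1 x)) ≠ q₀.1 x)
    (hσ : altSub (n + 2) n ⊔ (altSub (n + 2) n).map (MulAut.conj σ⁻¹).toMonoidHom = ⊤) :
    Admissible n q₀ q₁ σ := by
  refine ⟨notMem_altSub_of_forall_apply_ne f0, notMem_altSub_of_forall_apply_ne f1,
    two_lt_orderOf_of_apply_ne t0.choose_spec, two_lt_orderOf_of_apply_ne t1.choose_spec,
    ?_, ?_, ?_, ?_, ?_, ?_, hσ⟩
  · rintro r x y ⟨i, hi⟩ ⟨j, hj⟩ ⟨hx, hy⟩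
    obtain ⟨c, rfl⟩ := isConj_iff.1 hx
    obtain ⟨d, rfl⟩ := isConj_iff.1 hy
    have h := (Commute.refl r).zpow_zpow i j
    rw [show r ^ i = _ from hi, show r ^ j = _ from hj] at h
    have h1 : Commute (c⁻¹ * (c * q₀ * c⁻¹) * c⁻¹⁻¹) (c⁻¹ * (d * q₁ * d⁻¹) * c⁻¹⁻¹) :=
      h.map (MulAut.conj c⁻¹).toMonoidHom
    have h2 : c⁻¹ * (c * q₀ * c⁻¹) * c⁻¹⁻¹ = q₀ := by group
    have h3 : c⁻¹ * (d * q₁ * d⁻¹) * c⁻¹⁻¹ = c⁻¹ * d * q₁ * (c⁻¹ * d)⁻¹ := by group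
    rw [h2, h3] at h1
    exact hcomm (c⁻¹ * d) h1
  · have h := zpowers_inf_eq_bot ha hm hqm htrans
    refine (Subgroup.eq_bot_iff_forall _).2 ?_
    rintro z ⟨⟨i, hi⟩, ⟨j, hj⟩⟩
    refine Subtype.ext ((Subgroup.eq_bot_iff_forall _).1 h z.1 ⟨⟨i, ?_⟩, ⟨j, ?_⟩⟩)
    · rw [← hi]; rfl
    · rw [← hj]; rfl
  · obtain ⟨z, w, h1, h2⟩ := h5
    intro h
    have h3 : q₀ * q₁⁻¹ * q₀ = q₁ := by
      rw [pow_two] at h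
      exact mul_inv_eq_one.1 (by rw [← h]; group)
    refine h2 ?_
    rw [← congrArg (fun g : Alt (n + 2) => g.1 z) h3]
    change q₀.1 w = q₀.1 (q₁.1⁻¹ (q₀.1 z))
    rw [← h1, perm_inv_apply_self]
  · obtain ⟨x, w, h1, h2⟩ := h6
    intro h
    have h3 : q₀ * q₁⁻¹ * q₀ * q₁ = 1 := by
      rw [← h]; simp [pow_two, mul_assoc]
    refine h2 ?_
    have := congrArg (fun g : Alt (n + 2) => g.1 x) h3
    change q₀.1 (q₁.1⁻¹ (q₀.1 (q₁.1 x))) = x at this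
    rwa [← h1, perm_inv_apply_self] at this
  · obtain ⟨x, hx⟩ := h7
    intro h
    have h3 : q₁ * q₀ = q₀ * q₁ := by
      calc q₁ * q₀ = q₀ * (q₀⁻¹ * q₁ * q₀) := by group
        _ = q₀ * q₁ := by rw [h]
    exact hx (congrArg (fun g : Alt (n + 2) => g.1 x) h3)
  · obtain ⟨x, hx⟩ := h7'
    intro h
    have h3 : q₁ * (q₀ * q₁) = q₀ := by
      have : q₁ * q₀ = q₀ * q₁⁻¹ := by rw [← h]; group
      rw [← mul_assoc, this, inv_mul_cancel_right]
    exact hx (congrArg (fun g : Alt (n + 2) => g.1 x) h3)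

theorem val_finRotate (x : Fin (n + 2)) :
    (finRotate (n + 2) x).val = if x.val = n + 1 then 0 else x.val + 1 := by
  rw [coe_finRotate]
  simp [Fin.ext_iff]

theorem val_finRotate_inv (x : Fin (n + 2)) :
    ((finRotate (n + 2))⁻¹ x).val = if x.val = 0 then n + 1 else x.val - 1 := by
  obtain ⟨y, rfl⟩ := (finRotate (n + 2)).surjective x
  have h := val_finRotate y
  have := y.2
  rw [perm_inv_apply_self]
  split_ifs at h ⊢ <;> omega

theorem forall_mem_of_val_pred {s : Set (Fin (n + 2))} {a : Fin (n + 2)} (ha : a ∈ s)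
    (h : ∀ x ∈ s, ((finRotate (n + 2))⁻¹ x) ∈ s) (x : Fin (n + 2)) : x ∈ s := by
  have key : ∀ k, ∀ a ∈ s, k ≤ a.val → ∀ x : Fin (n + 2), x.val + k = a.val → x ∈ s := by
    intro k
    induction k with
    | zero => intro a ha _ x hx; rwa [show x = a from Fin.ext hx]
    | succ k ih =>
      intro a ha hk x hx
      have h1 := val_finRotate_inv a
      rw [if_neg (by omega)] at h1
      exact ih _ (h a ha) (by omega) x (by omega)
  have h0 : (⟨0, by omega⟩ : Fin (n + 2)) ∈ s := key a.val a ha le_rfl _ (by simp)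
  have h1 : (⟨n + 1, by omega⟩ : Fin (n + 2)) ∈ s := by
    have := h _ h0
    rwa [show (⟨n + 1, by omega⟩ : Fin (n + 2)) = (finRotate (n + 2))⁻¹ ⟨0, by omega⟩ from
      Fin.ext (by rw [val_finRotate_inv]; simp)]
  have := x.2
  exact key (n + 1 - x.val) _ h1 (by simp) x (by simp only; omega)

theorem mem_alternatingGroup_finRotate_mul_swap (hn : Even n) {a b : Fin (n + 2)} (hab : a ≠ b) :
    finRotate (n + 2) * Equiv.swap a b ∈ alternatingGroup (Fin (n + 2)) := by
  rw [Equiv.Perm.mem_alternatingGroup, Equiv.Perm.sign_mul, sign_finRotate,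
    Equiv.Perm.sign_swap hab]
  simp [pow_succ, hn.neg_one_pow]

theorem mem_alternatingGroup_finRotate (hn : Odd n) :
    finRotate (n + 2) ∈ alternatingGroup (Fin (n + 2)) := by
  rw [Equiv.Perm.mem_alternatingGroup, sign_finRotate]
  simp [pow_succ, hn.neg_one_pow]

theorem val_swap_apply (a b x : Fin (n + 2)) :
    (Equiv.swap a b x).val = if x.val = a.val then b.val else if x.val = b.val then a.val
      else x.val := by
  simp only [Equiv.swap_apply_def, Fin.ext_iff]
  split_ifs <;> rfl

/-- The permutation is (1 2)(0 3 4 … n+1). -/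
theorem exists_alt_val_eq_of_even₀ (hn : 5 ≤ n) (he : Even n) :
    ∃ q : Alt (n + 2), ∀ x, (q.1 x).val = if x.val = 0 then 3 else if x.val = 2 then 1 else
      if x.val = n + 1 then 0 else x.val + 1 := by
  let p (k : ℕ) (hk : k < n + 2) : Fin (n + 2) := ⟨k, hk⟩
  have hp : ∀ {j k hj hk}, j ≠ k → p j hj ≠ p k hk := fun h h' => h (congrArg Fin.val h')
  have h0 : 0 < n + 2 := by omega
  have h2 : 2 < n + 2 := by omega
  refine ⟨⟨finRotate (n + 2) * Equiv.swap (p 0 h0) (p 2 h2),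
    mem_alternatingGroup_finRotate_mul_swap he (hp (by omega))⟩, ?_⟩
  intro x
  change (finRotate (n + 2) (Equiv.swap (p 0 h0) (p 2 h2) x)).val = _
  have a := val_swap_apply (p 0 h0) (p 2 h2) x
  have b := val_finRotate (Equiv.swap (p 0 h0) (p 2 h2) x)
  simp only [p] at a b ⊢
  split_ifs at a b ⊢ <;> omega

/-- The permutation is (0 2 1)(3 n+1 n … 4). -/
theorem exists_alt_val_eq_of_even₁ (hn : 5 ≤ n) (he : Even n) :
    ∃ q : Alt (n + 2), ∀ x, (q.1 x).val = if x.val = 0 then 2 else if x.val = 3 then n + 1 else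
      x.val - 1 := by
  let p (k : ℕ) (hk : k < n + 2) : Fin (n + 2) := ⟨k, hk⟩
  have hp : ∀ {j k hj hk}, j ≠ k → p j hj ≠ p k hk := fun h h' => h (congrArg Fin.val h')
  have h0 : 0 < n + 2 := by omega
  have h3 : 3 < n + 2 := by omega
  refine ⟨⟨(finRotate (n + 2))⁻¹ * Equiv.swap (p 0 h0) (p 3 h3), by
    have := mem_alternatingGroup_finRotate_mul_swap he (hp (hj := h0) (hk := h3) (by omega))
    rw [Equiv.Perm.mem_alternatingGroup] at this ⊢
    rwa [Equiv.Perm.sign_mul, Equiv.Perm.sign_inv, ← Equiv.Perm.sign_mul]⟩, ?_⟩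
  intro x
  change ((finRotate (n + 2))⁻¹ (Equiv.swap (p 0 h0) (p 3 h3) x)).val = _
  have a := val_swap_apply (p 0 h0) (p 3 h3) x
  have b := val_finRotate_inv (Equiv.swap (p 0 h0) (p 3 h3) x)
  simp only [p] at a b ⊢
  split_ifs at a b ⊢ <;> omega

theorem admissible_of_val_eq_of_even (hn : 5 ≤ n) (he : Even n) {q₀ q₁ σ : Alt (n + 2)}
    (e0 : ∀ x, (q₀.1 x).val = if x.val = 0 then 3 else if x.val = 2 then 1 else
      if x.val = n + 1 then 0 else x.val + 1)
    (e1 : ∀ x, (q₁.1 x).val = if x.val = 0 then 2 else if x.val = 3 then n + 1 else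
      x.val - 1)
    (hσ : altSub (n + 2) n ⊔ (altSub (n + 2) n).map (MulAut.conj σ⁻¹).toMonoidHom = ⊤) :
    Admissible n q₀ q₁ σ := by
  -- The witness 3 for (q₀q₁⁻¹)² ≠ 1 compares 6 with n + 1, so n = 5 must be excluded by parity.
  have hn6 : 6 ≤ n := by
    rcases hn.eq_or_lt with rfl | h
    · exact absurd he (by decide)
    · exact h
  let p (k : ℕ) (hk : k < n + 2) : Fin (n + 2) := ⟨k, hk⟩
  have hp : ∀ {j k hj hk}, j ≠ k → p j hj ≠ p k hk := fun h h' => h (congrArg Fin.val h')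
  have h0 : 0 < n + 2 := by omega
  have h1 : 1 < n + 2 := by omega
  have h2 : 2 < n + 2 := by omega
  have h3 : 3 < n + 2 := by omega
  have h4 : 4 < n + 2 := by omega
  have h5 : 5 < n + 2 := by omega
  have h6 : 6 < n + 2 := by omega
  have hl : n + 1 < n + 2 := by omega
  have w0 : ∀ {j k} (hj : j < n + 2) (hk : k < n + 2),
      (j = 0 ∧ k = 3 ∨ j = 2 ∧ k = 1 ∨ j = n + 1 ∧ k = 0 ∨
        j ≠ 0 ∧ j ≠ 2 ∧ j ≠ n + 1 ∧ k = j + 1) →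
      q₀.1 (p j hj) = p k hk := by
    intro j k hj hk h
    have := e0 (p j hj)
    refine Fin.ext ?_
    simp only [p] at this ⊢
    split_ifs at this <;> omega
  have w1 : ∀ {j k} (hj : j < n + 2) (hk : k < n + 2),
      (j = 0 ∧ k = 2 ∨ j = 3 ∧ k = n + 1 ∨ j ≠ 0 ∧ j ≠ 3 ∧ k = j - 1) →
      q₁.1 (p j hj) = p k hk := by
    intro j k hj hk h
    have := e1 (p j hj)
    refine Fin.ext ?_
    simp only [p] at this ⊢
    split_ifs at this <;> omega
  have e1sq : ∀ x, q₁.1 (q₁.1 x) ≠ x := by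
    intro x hx
    have a := e1 x
    have b := e1 (q₁.1 x)
    rw [hx] at b
    split_ifs at a b <;> omega
  have f1 : ∀ x, q₁.1 x ≠ x := fun x hx => e1sq x (by rw [hx, hx])
  have a1 : q₀.1 (p 1 h1) = p 2 h2 := w0 _ _ (by omega)
  have a2 : q₀.1 (p 2 h2) = p 1 h1 := w0 _ _ (by omega)
  refine Admissible.of_apply (a := p 1 h1) (m := 3) ?_ f1 ?_ ⟨p 0 h0, e1sq _⟩
    (by rw [a1, a2]) (by decide) ?_ ?_ ?_ ⟨p 3 h3, p 5 h5, ?_⟩ ⟨p 3 h3, p 1 h1, ?_⟩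
    ⟨p 1 h1, ?_⟩ ⟨p 1 h1, ?_⟩ hσ
  · intro x hx
    have a := e0 x
    rw [hx] at a
    split_ifs at a <;> omega
  · exact ⟨p 0 h0, by rw [w0 h0 h3 (by omega), w0 h3 h4 (by omega)]; exact hp (by omega)⟩
  · change q₁.1 (q₁.1 (q₁.1 (p 1 h1))) = _
    rw [w1 h1 h0 (by omega), w1 h0 h2 (by omega), w1 h2 h1 (by omega)]
  · intro s h1s hs0 hs1
    have h2s : p 2 h2 ∈ s := a1 ▸ hs0 _ h1s
    have h0s : p 0 h0 ∈ s := by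
      have : q₁.1 (p 1 h1) = p 0 h0 := w1 _ _ (by omega)
      exact this ▸ hs1 _ h1s
    have hge : ∀ k (hk : k + 3 < n + 2), p (k + 3) hk ∈ s := by
      intro k
      induction k with
      | zero =>
        intro hk
        have : q₀.1 (p 0 h0) = p 3 h3 := w0 _ _ (by omega)
        exact this ▸ hs0 _ h0s
      | succ k ih =>
        intro hk
        have : q₀.1 (p (k + 3) (by omega)) = p (k + 1 + 3) hk :=
          w0 _ _ (by omega)
        exact this ▸ hs0 _ (ih (by omega))
    rintro ⟨x, hx⟩
    rcases (show x = 0 ∨ x = 1 ∨ x = 2 ∨ 3 ≤ x by omega) with rfl | rfl | rfl | h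
    · exact h0s
    · exact h1s
    · exact h2s
    · obtain ⟨k, rfl⟩ := Nat.exists_eq_add_of_le' h
      exact hge k hx
  -- A conjugate of q₁ commuting with q₀ preserves {1, 2}, the fixed points of q₀². Having no fixed
  -- points, it swaps 1 and 2, so its square fixes a point; but q₁² fixes none.
  · intro k hk
    have hc : ∀ x, q₀.1 (k.1 (q₁.1 (k.1⁻¹ x))) = k.1 (q₁.1 (k.1⁻¹ (q₀.1 x))) := fun x =>
      congrArg (fun g : Alt (n + 2) => g.1 x) hk.eq
    have hfix : ∀ x, q₀.1 (q₀.1 x) = x → x = p 1 h1 ∨ x = p 2 h2 := by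
      intro x hx
      have a := e0 x
      have b := e0 (q₀.1 x)
      rw [hx] at b
      have hxlt := x.2
      have : x.val = 1 ∨ x.val = 2 := by
        split_ifs at a b <;> omega
      exact this.imp (fun h => Fin.ext h) (fun h => Fin.ext h)
    set y : Fin (n + 2) → Fin (n + 2) := fun x => k.1 (q₁.1 (k.1⁻¹ x)) with hy
    have hyx : ∀ x, y x ≠ x := fun x hx => f1 (k.1⁻¹ x) ((Equiv.Perm.eq_inv_iff_eq).2 hx)
    have hyfix : ∀ x, q₀.1 (q₀.1 x) = x → q₀.1 (q₀.1 (y x)) = y x := by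
      intro x hx
      have h1 : q₀.1 (y x) = y (q₀.1 x) := hc x
      have h2 : q₀.1 (y (q₀.1 x)) = y (q₀.1 (q₀.1 x)) := hc _
      rw [h1, h2, hx]
    have hy1 : y (p 1 h1) = p 2 h2 :=
      (hfix _ (hyfix _ (by rw [a1, a2]))).resolve_left (hyx _)
    have hy2 : y (p 2 h2) = p 1 h1 :=
      (hfix _ (hyfix _ (by rw [a2, a1]))).resolve_right (hyx _)
    have hyy : y (y (p 1 h1)) = p 1 h1 := by rw [hy1, hy2]
    simp only [hy, perm_inv_apply_self] at hyy
    exact e1sq _ (Equiv.Perm.eq_inv_iff_eq.2 hyy)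
  · constructor
    · rw [w1 h5 h4 (by omega),
      w0 h3 h4 (by omega)]
    · rw [w0 h5 h6 (by omega),
      w1 h3 hl (by omega)]
      exact hp (by omega)
  · constructor
    · rw [w1 h3 hl (by omega),
      w0 hl h0 (by omega),
      w1 h1 h0 (by omega)]
    · rw [w0 h1 h2 (by omega)]
      exact hp (by omega)
  · rw [w0 h1 h2 (by omega),
      w1 h2 h1 (by omega),
      w1 h1 h0 (by omega),
      w0 h0 h3 (by omega)]
    exact hp (by omega)
  · rw [w1 h1 h0 (by omega),
      w0 h0 h3 (by omega),
      w1 h3 hl (by omega),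
      w0 h1 h2 (by omega)]
    exact hp (by omega)

/-- The permutation is (1 2)(4 5)(0 3 6 7 … n+1). -/
theorem exists_alt_val_eq_of_odd₀ (hn : 5 ≤ n) (ho : Odd n) :
    ∃ q : Alt (n + 2), ∀ x, (q.1 x).val = if x.val = 0 then 3 else if x.val = 2 then 1 else
      if x.val = 3 then 6 else if x.val = 5 then 4 else
      if x.val = n + 1 then 0 else x.val + 1 := by
  let p (k : ℕ) (hk : k < n + 2) : Fin (n + 2) := ⟨k, hk⟩
  have hp : ∀ {j k hj hk}, j ≠ k → p j hj ≠ p k hk := fun h h' => h (congrArg Fin.val h')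
  have h0 : 0 < n + 2 := by omega
  have h2 : 2 < n + 2 := by omega
  have h3 : 3 < n + 2 := by omega
  have h5 : 5 < n + 2 := by omega
  refine ⟨⟨finRotate (n + 2) *
      (Equiv.swap (p 0 h0) (p 2 h2) * Equiv.swap (p 3 h3) (p 5 h5)),
    mul_mem (mem_alternatingGroup_finRotate ho) (by
      rw [Equiv.Perm.mem_alternatingGroup, Equiv.Perm.sign_mul,
        Equiv.Perm.sign_swap (hp (by omega)), Equiv.Perm.sign_swap (hp (by omega))]; rfl)⟩, ?_⟩
  intro x
  change (finRotate (n + 2) (Equiv.swap (p 0 h0) (p 2 h2)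
    (Equiv.swap (p 3 h3) (p 5 h5) x))).val = _
  have a := val_swap_apply (p 3 h3) (p 5 h5) x
  have b := val_swap_apply (p 0 h0) (p 2 h2) (Equiv.swap (p 3 h3) (p 5 h5) x)
  have c := val_finRotate (Equiv.swap (p 0 h0) (p 2 h2) (Equiv.swap (p 3 h3) (p 5 h5) x))
  have hx := x.2
  simp only [p] at a b c ⊢
  generalize (Equiv.swap (⟨3, h3⟩ : Fin (n + 2)) ⟨5, h5⟩) x = y at *
  generalize (Equiv.swap (⟨0, h0⟩ : Fin (n + 2)) ⟨2, h2⟩) y = z at *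
  split_ifs at a <;> split_ifs at b <;> split_ifs at c ⊢ <;> omega

theorem admissible_of_val_eq_of_odd (hn : 5 ≤ n) (ho : Odd n) {q₀ q₁ σ : Alt (n + 2)}
    (e0 : ∀ x, (q₀.1 x).val = if x.val = 0 then 3 else if x.val = 2 then 1 else
      if x.val = 3 then 6 else if x.val = 5 then 4 else
      if x.val = n + 1 then 0 else x.val + 1)
    (hq₁ : q₁.1 = (finRotate (n + 2))⁻¹)
    (hσ : altSub (n + 2) n ⊔ (altSub (n + 2) n).map (MulAut.conj σ⁻¹).toMonoidHom = ⊤) :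
    Admissible n q₀ q₁ σ := by
  have e1 : ∀ x, (q₁.1 x).val = if x.val = 0 then n + 1 else x.val - 1 := fun x => by
    rw [hq₁, val_finRotate_inv]
  let p (k : ℕ) (hk : k < n + 2) : Fin (n + 2) := ⟨k, hk⟩
  have hp : ∀ {j k hj hk}, j ≠ k → p j hj ≠ p k hk := fun h h' => h (congrArg Fin.val h')
  have h0 : 0 < n + 2 := by omega
  have h1 : 1 < n + 2 := by omega
  have h2 : 2 < n + 2 := by omega
  have h3 : 3 < n + 2 := by omega
  have h4 : 4 < n + 2 := by omega
  have h5 : 5 < n + 2 := by omega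
  have h6 : 6 < n + 2 := by omega
  have w0 : ∀ {j k} (hj : j < n + 2) (hk : k < n + 2),
      (j = 0 ∧ k = 3 ∨ j = 2 ∧ k = 1 ∨ j = 3 ∧ k = 6 ∨ j = 5 ∧ k = 4 ∨ j = n + 1 ∧ k = 0 ∨
        j ≠ 0 ∧ j ≠ 2 ∧ j ≠ 3 ∧ j ≠ 5 ∧ j ≠ n + 1 ∧ k = j + 1) →
      q₀.1 (p j hj) = p k hk := by
    intro j k hj hk h
    have := e0 (p j hj)
    refine Fin.ext ?_
    simp only [p] at this ⊢
    split_ifs at this <;> omega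
  have w1 : ∀ {j k} (hj : j < n + 2) (hk : k < n + 2), (j = 0 ∧ k = n + 1 ∨ j ≠ 0 ∧ k = j - 1) →
      q₁.1 (p j hj) = p k hk := by
    intro j k hj hk h
    have := e1 (p j hj)
    refine Fin.ext ?_
    simp only [p] at this ⊢
    split_ifs at this <;> omega
  have hall : ∀ {s : Set (Fin (n + 2))} {a}, a ∈ s → (∀ x ∈ s, q₁.1 x ∈ s) → ∀ x, x ∈ s :=
    by
    rw [hq₁]; exact fun ha h => forall_mem_of_val_pred ha h
  have a1 : q₀.1 (p 1 h1) = p 2 h2 := w0 _ _ (by omega)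
  have a2 : q₀.1 (p 2 h2) = p 1 h1 := w0 _ _ (by omega)
  have t0 : q₀.1 (q₀.1 (p 0 h0)) ≠ p 0 h0 := by
    rw [w0 h0 h3 (by omega),
      w0 h3 h6 (by omega)]
    exact hp (by omega)
  refine Admissible.of_apply (a := p 1 h1) (m := n + 2) ?_ ?_ ⟨_, t0⟩ ⟨p 2 h2, ?_⟩
    (by rw [a1, a2]) (ho.add_even (by decide)) ?_ (fun s ha _ h => hall ha h) ?_
    ⟨p 1 h1, p 3 h3, ?_⟩ ⟨p 1 h1, p 4 h4, ?_⟩ ⟨p 1 h1, ?_⟩ ⟨p 3 h3, ?_⟩ hσ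
  · intro x hx
    have a := e0 x
    rw [hx] at a
    split_ifs at a <;> omega
  · intro x hx
    have a := e1 x
    rw [hx] at a
    split_ifs at a <;> omega
  · rw [w1 h2 h1 (by omega),
      w1 h1 h0 (by omega)]
    exact hp (by omega)
  · have horder : orderOf (finRotate (n + 2)) = n + 2 := by
      rw [isCycle_finRotate.orderOf, support_finRotate]; simp
    have : q₁.1 ^ (n + 2) = 1 := by
      rw [hq₁, inv_pow, inv_eq_one, ← orderOf_dvd_iff_pow_eq_one, horder]
    rw [this]; rfl
  -- A conjugate of q₁ is an (n+2)-cycle, hence transitive. If it commuted with q₀ it would preserve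
  -- the fixed points of q₀², which include 1 but not 0.
  · intro k hk
    have hc : ∀ x, q₀.1 (k.1 (q₁.1 (k.1⁻¹ x))) = k.1 (q₁.1 (k.1⁻¹ (q₀.1 x))) := fun x =>
      congrArg (fun g : Alt (n + 2) => g.1 x) hk.eq
    have hmem : ∀ x, x ∈ {x | q₀.1 (q₀.1 (k.1 x)) = k.1 x} := by
      refine hall (a := k.1⁻¹ (p 1 h1)) ?_ fun x hx => ?_
      · simp [a1, a2]
      · have e := hc (k.1 x)
        have e' := hc (q₀.1 (k.1 x))
        rw [perm_inv_apply_self] at e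
        change q₀.1 (q₀.1 (k.1 (q₁.1 x))) = k.1 (q₁.1 x)
        rw [e, e', show q₀.1 (q₀.1 (k.1 x)) = k.1 x from hx, perm_inv_apply_self]
    exact t0 (by simpa using hmem (k.1⁻¹ (p 0 h0)))
  · constructor
    · rw [w1 h3 h2 (by omega),
      w0 h1 h2 (by omega)]
    · rw [w0 h3 h6 (by omega),
      w1 h1 h0 (by omega)]
      exact hp (by omega)
  · constructor
    · rw [w1 h4 h3 (by omega),
      w1 h1 h0 (by omega),
      w0 h0 h3 (by omega)]
    · rw [w0 h4 h5 (by omega)]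
      exact hp (by omega)
  · rw [w0 h1 h2 (by omega),
      w1 h2 h1 (by omega),
      w1 h1 h0 (by omega),
      w0 h0 h3 (by omega)]
    exact hp (by omega)
  · rw [w1 h3 h2 (by omega),
      w0 h2 h1 (by omega),
      w1 h1 h0 (by omega),
      w0 h3 h6 (by omega)]
    exact hp (by omega)

theorem exists_admissible (hn : 5 ≤ n) : ∃ q₀ q₁ σ : Alt (n + 2), Admissible n q₀ q₁ σ := by
  obtain ⟨σ, hσ⟩ := exists_conjGenerates hn
  rcases n.even_or_odd with h | h
  · obtain ⟨q₀, e0⟩ := exists_alt_val_eq_of_even₀ hn h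
    obtain ⟨q₁, e1⟩ := exists_alt_val_eq_of_even₁ hn h
    exact ⟨q₀, q₁, σ, admissible_of_val_eq_of_even hn h e0 e1 hσ⟩
  · obtain ⟨q₀, e0⟩ := exists_alt_val_eq_of_odd₀ hn h
    exact ⟨q₀, ⟨_, inv_mem (mem_alternatingGroup_finRotate h)⟩, σ,
      admissible_of_val_eq_of_odd hn h e0 rfl hσ⟩

end Existence

end SpinalGroups

theorem mainTheorem3 :
    (∃ (X : Type) (_ : Finite X) (G : Subgroup (TreeAut X)),
      IsBranch G ∧ IsPeriodic G ∧ ¬ IsMF G) ∧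
    ∀ n : ℕ, 5 ≤ n →
      (∃ q₀ q₁ σ : Alt (n + 2), Admissible n q₀ q₁ σ) ∧
      ∀ q₀ q₁ σ : Alt (n + 2), Admissible n q₀ q₁ σ →
        ∀ D T G H : Subgroup (TreeAut (Alt (n + 2))),
          D = directedAlt n q₀ q₁ σ (n + 1) → T = directedAlt n q₀ q₁ σ n →
          G = spinalGroup D → H = spinalGroup T →
            IsConstantSpinal G D ∧ IsLayered G ∧ IsBranch G ∧ IsPeriodic G ∧
            ¬ IsMF G ∧
            IsSpecial H G D ∧ IsConstantSpinal H T ∧ IsLayered H ∧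
            IsMaximalOfInfiniteIndex H G := by
  refine ⟨?_, fun n hn => ⟨exists_admissible hn, ?_⟩⟩
  · obtain ⟨q₀, q₁, σ, h⟩ := exists_admissible (n := 5) le_rfl
    exact ⟨Alt 7, inferInstance, spinalGroup (directedAlt 5 q₀ q₁ σ 6),
      (h.isLayered le_rfl (by omega) (by omega)).isBranch, h.isPeriodic,
      (h.isMaximalOfInfiniteIndex le_rfl).not_isMF⟩
  · rintro q₀ q₁ σ h D T G H rfl rfl rfl rfl
    have hG := h.isLayered hn n.le_succ (by omega)
    have hmax := h.isMaximalOfInfiniteIndex hn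
    exact ⟨h.isConstantSpinal n.le_succ, hG, hG.isBranch, h.isPeriodic, hmax.not_isMF,
      isSpecial_spinalGroup (Subgroup.map_mono (altSub_mono n.le_succ)),
      h.isConstantSpinal le_rfl, h.isLayered hn le_rfl (by omega), hmax⟩
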